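/- Let $X$ be a proper ${\rm CAT}(0)$-space, let ${\rm Iso}(X)$ be its isometry group with the compact open topology, and let $G<{\rm Iso}(X)$ be a closed subgroup with limit set $\Lambda\subset\partial X$ (the set of accumulation points in the visual boundary $\partial X$ of the $G$-orbits on $X$). Assume that * $G$ is non-elementary, i.e. $\Lambda$ contains at least three points and $G$ fixes no point of $\partial X$; * $G$ contains a rank-one element, i.e. an axial isometry having, for some $B>0$, a $B$-contracting axis $\gamma$ (every closed metric ball disjoint from $\gamma$ has shortest-distance projection to $\gamma$ of diameter at most $B$); * $G$ acts transitively on the set of ordered pairs of distinct points of $\Lambda$. Let ${\cal P}_{\geq 3}(\Lambda)$ be the space of Borel probability measures on $\Lambda$ which are not concentrated on at most two points, with the weak$^*$-topology, and let $T\subset\Lambda^3$ be the space of triples of pairwise distinct points. Then: 1. The action of $G$ on ${\cal P}_{\geq 3}(\Lambda)$ is tame: its orbits are locally closed and the quotient Borel structure on ${\cal P}_{\geq 3}(\Lambda)/G$ is countably separated. 2. The stabilizer in $G$ of every $\mu\in{\cal P}_{\geq 3}(\Lambda)$ is compact. 3. The action of $G$ on $T$ is proper, i.e. $(g,t)\mapsto(gt,t)$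 is a proper map $G\times T\to T\times T$. 4. There are a number $R>0$ and a continuous $G$-equivariant map $\Phi:T\to X$ such that for every $(a,b,c)\in T$ the set $K(a,b,c)$ of all points of $X$ whose distance to each side of each ideal geodesic triangle with vertices $a,b,c$ is at most $R$ is non-empty and compact, and $\Phi(a,b,c)$ is a center of $K(a,b,c)$: a point $x$ for which the radius of the smallest closed ball about $x$ containing $K(a,b,c)$ is minimal. -/

import Mathlib

open Set Filter Topology MeasureTheory
open scoped NNReal

namespace RankOneCAT0

/-! ### CAT(0) spaces -/

/-- Any two points of `X` are joined by a geodesic segment. -/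
def IsGeodesicSpace (X : Type*) [MetricSpace X] : Prop :=
  ∀ x y : X, ∃ γ : ℝ → X, γ 0 = x ∧ γ (dist x y) = y ∧
    ∀ s ∈ Icc 0 (dist x y), ∀ t ∈ Icc 0 (dist x y), dist (γ s) (γ t) = |s - t|

/-- A geodesic metric space in which geodesic triangles are not thicker than their Euclidean
comparison triangles. In a geodesic space, `x` lies on some geodesic segment from `p` to `q` iff
`dist p x + dist x q = dist p q`; so `x` and `y` below are arbitrary points on two sides of an
arbitrary geodesic triangle with vertices `p, q, r`, and `x', y'` are their comparison points in
a comparison triangle `p', q', r'`. -/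
structure IsCAT0 (X : Type*) [MetricSpace X] : Prop where
  geodesic : IsGeodesicSpace X
  comparison : ∀ p q r x y : X,
    dist p x + dist x q = dist p q → dist p y + dist y r = dist p r →
    ∀ p' q' r' x' y' : EuclideanSpace ℝ (Fin 2),
      dist p' q' = dist p q → dist q' r' = dist q r → dist p' r' = dist p r →
      dist p' x' = dist p x → dist x' q' = dist x q →
      dist p' y' = dist p y → dist y' r' = dist y r →
      dist x y ≤ dist x' y'

/-! ### Rays, lines, the visual boundary and the cone topology -/

/-- Geodesic rays `[0, ∞) → X`. -/
structure GeodesicRay (X : Type*) [MetricSpace X] where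
  toFun : ℝ≥0 → X
  isometry : Isometry toFun

/-- Geodesic lines `ℝ → X`. -/
structure GeodesicLine (X : Type*) [MetricSpace X] where
  toFun : ℝ → X
  isometry : Isometry toFun

section Boundary

variable {X : Type*} [MetricSpace X]

instance : CoeFun (GeodesicRay X) (fun _ => ℝ≥0 → X) := ⟨GeodesicRay.toFun⟩

instance : CoeFun (GeodesicLine X) (fun _ => ℝ → X) := ⟨GeodesicLine.toFun⟩

/-- Two rays are asymptotic if they stay at bounded distance from each other. -/
instance asymptoticSetoid (X : Type*) [MetricSpace X] : Setoid (GeodesicRay X) where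
  r c c' := ∃ C : ℝ, ∀ t : ℝ≥0, dist (c t) (c' t) ≤ C
  iseqv :=
    { refl := fun c => ⟨0, fun t => (dist_self (c t)).le⟩
      symm := fun ⟨C, h⟩ => ⟨C, fun t => by rw [dist_comm]; exact h t⟩
      trans := fun ⟨C, h⟩ ⟨D, k⟩ =>
        ⟨C + D, fun t => (dist_triangle _ _ _).trans (add_le_add (h t) (k t))⟩ }

/-- The visual boundary `∂X`: asymptote classes of geodesic rays. -/
def Boundary (X : Type*) [MetricSpace X] : Type _ := Quotient (asymptoticSetoid X)

/-- The endpoint `c(∞)` of a ray. -/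
def GeodesicRay.endpoint (c : GeodesicRay X) : Boundary X := Quotient.mk _ c

/-- The endpoint `γ(∞)` of a line. -/
def GeodesicLine.posEnd (γ : GeodesicLine X) : Boundary X :=
  GeodesicRay.endpoint ⟨fun t => γ (t : ℝ), γ.isometry.comp (Isometry.of_dist_eq fun _ _ => rfl)⟩

/-- The endpoint `γ(-∞)` of a line. -/
def GeodesicLine.negEnd (γ : GeodesicLine X) : Boundary X :=
  GeodesicRay.endpoint ⟨fun t => γ (-(t : ℝ)),
    γ.isometry.comp ((IsometryEquiv.neg ℝ).isometry.comp (Isometry.of_dist_eq fun _ _ => rfl))⟩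

/-- The set `X ∪ ∂X`. -/
inductive Bordification (X : Type*) [MetricSpace X] : Type _
  | point (x : X) : Bordification X
  | ideal (ξ : Boundary X) : Bordification X

/-- The basic neighbourhood `U(c, r, ε)` of the endpoint of the ray `c`: all `z ∈ X ∪ ∂X` at
distance more than `r` from `c 0` such that the point at distance `r` from `c 0` on the geodesic
from `c 0` to `z` has distance less than `ε` from `c r`. -/
def coneNhd (c : GeodesicRay X) (r : ℝ≥0) (ε : ℝ) : Set (Bordification X) :=
  {z | (∃ x : X, z = .point x ∧ (r : ℝ) < dist (c 0) x ∧
          ∃ p : X, dist (c 0) p = r ∧ dist p x = dist (c 0) x - r ∧ dist p (c r) < ε) ∨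
       (∃ c' : GeodesicRay X, z = .ideal c'.endpoint ∧ c' 0 = c 0 ∧ dist (c' r) (c r) < ε)}

/-- The cone topology on `X ∪ ∂X`, generated by the open sets of `X` and the sets `U(c, r, ε)`. -/
instance (X : Type*) [MetricSpace X] : TopologicalSpace (Bordification X) :=
  TopologicalSpace.generateFrom
    ({U | ∃ V : Set X, IsOpen V ∧ U = Bordification.point '' V} ∪
     {U | ∃ (c : GeodesicRay X) (r : ℝ≥0) (ε : ℝ), 0 < r ∧ 0 < ε ∧ U = coneNhd c r ε})

/-- The visual boundary carries the subspace topology of the cone topology. -/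
instance (X : Type*) [MetricSpace X] : TopologicalSpace (Boundary X) :=
  TopologicalSpace.induced Bordification.ideal inferInstance

instance (X : Type*) [MetricSpace X] : MeasurableSpace (Boundary X) := borel _

instance (X : Type*) [MetricSpace X] : BorelSpace (Boundary X) := ⟨rfl⟩

/-! ### The isometry group and its actions -/

/-- The compact open topology on the isometry group. -/
instance (X : Type*) [MetricSpace X] : TopologicalSpace (X ≃ᵢ X) :=
  TopologicalSpace.induced (fun g => (⟨g, g.continuous⟩ : C(X, X))) ContinuousMap.compactOpen

/-- The image of a ray under an isometry. -/
def GeodesicRay.map (g : X ≃ᵢ X) (c : GeodesicRay X) : GeodesicRay X :=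
  ⟨fun t => g (c t), g.isometry.comp c.isometry⟩

/-- `Iso(X)` acts on `∂X` by `g • c(∞) = (g ∘ c)(∞)`. -/
instance (X : Type*) [MetricSpace X] : MulAction (X ≃ᵢ X) (Boundary X) where
  smul g := Quotient.map (GeodesicRay.map g) fun _ _ ⟨C, h⟩ =>
    ⟨C, fun t => (g.dist_eq _ _).trans_le (h t)⟩
  one_smul ξ := by
    induction ξ using Quotient.inductionOn
    rfl
  mul_smul g h ξ := by
    induction ξ using Quotient.inductionOn
    rfl

theorem smul_endpoint (g : X ≃ᵢ X) (c : GeodesicRay X) :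
    g • c.endpoint = (c.map g).endpoint := rfl

/-- The action of an isometry on `X ∪ ∂X`. -/
def Bordification.map (g : X ≃ᵢ X) : Bordification X → Bordification X
  | .point x => .point (g x)
  | .ideal ξ => .ideal (g • ξ)

theorem Bordification.map_inv_map (g : X ≃ᵢ X) (z : Bordification X) :
    (z.map g).map g⁻¹ = z := by
  cases z with
  | point x => exact congrArg Bordification.point (g.symm_apply_apply x)
  | ideal ξ => exact congrArg Bordification.ideal (inv_smul_smul g ξ)

theorem Bordification.map_map_inv (g : X ≃ᵢ X) (z : Bordification X) :
    (z.map g⁻¹).map g = z := by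
  simpa using Bordification.map_inv_map g⁻¹ z

theorem Bordification.map_mem_coneNhd (g : X ≃ᵢ X) (c : GeodesicRay X) (r : ℝ≥0) (ε : ℝ)
    {z : Bordification X} (hz : z ∈ coneNhd c r ε) : z.map g ∈ coneNhd (c.map g) r ε := by
  rcases hz with ⟨x, rfl, h1, p, h2, h3, h4⟩ | ⟨c', rfl, h1, h2⟩
  · refine Or.inl ⟨g x, rfl, ?_, g p, ?_, ?_, ?_⟩
    · exact h1.trans_eq (g.dist_eq _ _).symm
    · exact (g.dist_eq _ _).trans h2
    · exact (g.dist_eq _ _).trans (h3.trans (congrArg (· - (r : ℝ)) (g.dist_eq _ _).symm))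
    · exact (g.dist_eq _ _).trans_lt h4
  · exact Or.inr ⟨c'.map g, rfl, congrArg g h1, (g.dist_eq _ _).trans_lt h2⟩

theorem GeodesicRay.map_inv_map (g : X ≃ᵢ X) (c : GeodesicRay X) : (c.map g).map g⁻¹ = c := by
  cases c with
  | mk f hf =>
    have h : (fun t => g⁻¹ (g (f t))) = f := funext fun t => g.symm_apply_apply (f t)
    simp only [GeodesicRay.map, h]

theorem Bordification.continuous_map (g : X ≃ᵢ X) : Continuous (Bordification.map g) := by
  refine continuous_generateFrom_iff.2 ?_
  rintro U (⟨V, hV, rfl⟩ | ⟨c, r, ε, hr, hε, rfl⟩)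
  · have : Bordification.map g ⁻¹' (Bordification.point '' V)
        = Bordification.point '' (g ⁻¹' V) := by
      ext z
      cases z <;> simp [Bordification.map]
    rw [this]
    exact TopologicalSpace.isOpen_generateFrom_of_mem
      (Or.inl ⟨_, hV.preimage g.continuous, rfl⟩)
  · have : Bordification.map g ⁻¹' coneNhd c r ε = coneNhd (c.map g⁻¹) r ε := by
      ext z
      constructor
      · intro hz
        simpa [Bordification.map_inv_map] using Bordification.map_mem_coneNhd g⁻¹ c r ε hz
      · intro hz
        have h := Bordification.map_mem_coneNhd g _ r ε hz
        have h' := GeodesicRay.map_inv_map g⁻¹ c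
        rw [inv_inv] at h'
        rwa [h'] at h
    rw [this]
    exact TopologicalSpace.isOpen_generateFrom_of_mem (Or.inr ⟨_, r, ε, hr, hε, rfl⟩)

theorem Boundary.continuous_smul (g : X ≃ᵢ X) : Continuous fun ξ : Boundary X => g • ξ :=
  continuous_induced_rng.2
    ((Bordification.continuous_map g).comp (continuous_induced_dom (f := Bordification.ideal)) :
      Continuous (Bordification.ideal ∘ fun ξ : Boundary X => g • ξ))

/-! ### Limit sets and non-elementary groups -/

/-- The limit set of `G` as a `G`-invariant subset of `∂X`: the accumulation points in `∂X` of
the orbits of `G` on `X`. -/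
def limitSet (G : Subgroup (X ≃ᵢ X)) : SubMulAction G (Boundary X) where
  carrier := {ξ | ∃ x : X, AccPt (Bordification.ideal ξ)
    (𝓟 {z | ∃ g ∈ G, z = Bordification.point (g x)})}
  smul_mem' := by
    rintro ⟨g, hg⟩ ξ ⟨x, hx⟩
    refine ⟨x, ?_⟩
    have hinj : Function.Injective (Bordification.map g) :=
      Function.LeftInverse.injective (g := Bordification.map g⁻¹) (Bordification.map_inv_map g)
    have h := AccPt.map hx (Bordification.continuous_map g).continuousAt hinj
    rw [map_principal] at h
    refine h.mono (principal_mono.2 ?_)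
    rintro _ ⟨_, ⟨k, hk, rfl⟩, rfl⟩
    exact ⟨g * k, G.mul_mem hg hk, rfl⟩

/-- `G` is non-elementary: its limit set has at least three points, and `G` has no global fixed
point in `∂X`. -/
def IsNonElementary (G : Subgroup (X ≃ᵢ X)) : Prop :=
  3 ≤ (limitSet G : Set (Boundary X)).encard ∧ ¬ ∃ ξ : Boundary X, ∀ g : G, g • ξ = ξ

/-! ### Rank-one isometries -/

/-- The image of `K` under the shortest distance projection to `S`. -/
def projectionImage (S K : Set X) : Set X :=
  {p | p ∈ S ∧ ∃ x ∈ K, ∀ q ∈ S, dist x p ≤ dist x q}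

/-- `γ` is `B`-contracting: every closed metric ball disjoint from `γ` projects to a subset of
`γ` of diameter at most `B`. -/
def IsContracting (B : ℝ) (γ : GeodesicLine X) : Prop :=
  ∀ (x : X) (r : ℝ), Disjoint (Metric.closedBall x r) (range γ) →
    ∀ p ∈ projectionImage (range γ) (Metric.closedBall x r),
    ∀ q ∈ projectionImage (range γ) (Metric.closedBall x r), dist p q ≤ B

/-- The displacement function of `g` assumes its minimum `τ`, and `τ` is positive. -/
def IsAxialWith (g : X ≃ᵢ X) (τ : ℝ) : Prop :=
  0 < τ ∧ (∃ x, dist x (g x) = τ) ∧ ∀ x, τ ≤ dist x (g x)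

/-- `g` is axial and admits a `B`-contracting (oriented) axis for some `B > 0`. -/
def IsRankOne (g : X ≃ᵢ X) : Prop :=
  ∃ B > 0, ∃ τ : ℝ, IsAxialWith g τ ∧
    ∃ γ : GeodesicLine X, (∀ t, g (γ t) = γ (t + τ)) ∧ IsContracting B γ

/-! ### Triples of limit points and their centers -/

/-- Ordered triples of pairwise distinct points of the limit set. -/
def limitTriples (G : Subgroup (X ≃ᵢ X)) :
    SubMulAction G (limitSet G × limitSet G × limitSet G) where
  carrier := {t | t.1 ≠ t.2.1 ∧ t.2.1 ≠ t.2.2 ∧ t.2.2 ≠ t.1}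
  smul_mem' g _ h :=
    ⟨fun e => h.1 (MulAction.injective g e), fun e => h.2.1 (MulAction.injective g e),
      fun e => h.2.2 (MulAction.injective g e)⟩

/-- The vertices of a triple. -/
def vertices {G : Subgroup (X ≃ᵢ X)} (t : limitTriples G) : Set (Boundary X) :=
  {(t.1.1 : Boundary X), (t.1.2.1 : Boundary X), (t.1.2.2 : Boundary X)}

/-- The points of `X` whose distance to every side of every ideal geodesic triangle with the
vertices `t` is at most `R`. (The two endpoints of a geodesic line are always distinct.) -/
def quasiCenters {G : Subgroup (X ≃ᵢ X)} (R : ℝ) (t : limitTriples G) : Set X :=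
  {x | ∀ γ : GeodesicLine X, γ.negEnd ∈ vertices t → γ.posEnd ∈ vertices t →
    Metric.infDist x (range γ) ≤ R}

/-- `x` is a center of `K`: the radius of the smallest closed ball about `x` containing `K` is
minimal among all points of `X`. -/
def IsCenter (K : Set X) (x : X) : Prop :=
  ∀ (y : X) (r : ℝ), K ⊆ Metric.closedBall y r → K ⊆ Metric.closedBall x r

/-! ### Probability measures on the limit set -/

theorem limitSet_continuous_smul {G : Subgroup (X ≃ᵢ X)} (g : G) :
    Continuous fun ξ : limitSet G => g • ξ :=
  ((Boundary.continuous_smul (g : X ≃ᵢ X)).comp continuous_subtype_val).subtype_mk _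

/-- `G` acts on the Borel probability measures on its limit set by push-forward. -/
noncomputable instance (G : Subgroup (X ≃ᵢ X)) :
    MulAction G (ProbabilityMeasure (limitSet G)) where
  smul g μ := μ.map (f := fun ξ => g • ξ) (limitSet_continuous_smul g).measurable.aemeasurable
  one_smul μ := by
    apply Subtype.ext
    change Measure.map (fun ξ : limitSet G => (1 : G) • ξ) (μ : Measure (limitSet G)) = μ
    simp
  mul_smul g h μ := by
    apply Subtype.ext
    change Measure.map (fun ξ : limitSet G => (g * h) • ξ) (μ : Measure (limitSet G)) =
      Measure.map (fun ξ : limitSet G => g • ξ)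
        (Measure.map (fun ξ : limitSet G => h • ξ) (μ : Measure (limitSet G)))
    rw [Measure.map_map (limitSet_continuous_smul g).measurable
      (limitSet_continuous_smul h).measurable]
    simp only [Function.comp_def, mul_smul]

theorem toMeasure_smul {G : Subgroup (X ≃ᵢ X)} (g : G) (μ : ProbabilityMeasure (limitSet G)) :
    ((g • μ : ProbabilityMeasure (limitSet G)) : Measure (limitSet G)) =
      (μ : Measure (limitSet G)).map fun ξ => g • ξ := rfl

/-- The probability measures on the limit set that are not concentrated on at most two points;
as a subspace of `ProbabilityMeasure (limitSet G)` it carries the weak* topology. -/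
def measuresGeThree (G : Subgroup (X ≃ᵢ X)) :
    SubMulAction G (ProbabilityMeasure (limitSet G)) where
  carrier := {μ | ∀ a b : limitSet G, (μ : Measure (limitSet G)) {a, b}ᶜ ≠ 0}
  smul_mem' g μ hμ a b h := by
    let e : limitSet G ≃ₜ limitSet G :=
      { toEquiv := MulAction.toPerm g
        continuous_toFun := limitSet_continuous_smul g
        continuous_invFun := limitSet_continuous_smul g⁻¹ }
    have h1 : (μ : Measure (limitSet G)).map e.toMeasurableEquiv {a, b}ᶜ = 0 := h
    rw [MeasurableEquiv.map_apply] at h1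
    refine hμ (g⁻¹ • a) (g⁻¹ • b) (measure_mono_null ?_ h1)
    intro ξ hξ hab
    apply hξ
    have hab' : g • ξ = a ∨ g • ξ = b := hab
    rcases hab' with rfl | rfl <;> simp

end Boundary

/-! ### Tame actions -/

/-- An action on a topological space is tame if its orbits are locally closed and the quotient
Borel structure on the space of orbits is countably separated. -/
structure IsTameAction (G S : Type*) [Group G] [TopologicalSpace S] [MulAction G S] : Prop where
  isLocallyClosed_orbit : ∀ s : S, IsLocallyClosed (MulAction.orbit G s)
  countablySeparated : @MeasurableSpace.CountablySeparated (MulAction.orbitRel.Quotient G S)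
    ((borel S).map (Quotient.mk (MulAction.orbitRel G S)))

end RankOneCAT0

namespace RankOneCAT0

/-! ### Euclidean comparison triangles -/

/-! Both ends of a rank-one axis lie in Λ, so transitivity on pairs carries the axis to a
`B`-contracting line between any two distinct points of Λ, with one and the same `B`
(`exists_contractingPair`). Ideal triangles with such sides are thin: some point is within `12 * B`
of all three (`IsContracting.exists_center`), and lines with the same endpoints are uniformly close
(`IsContracting.infDist_le_add`). Hence the largest distance to a side, `triangleDist t`, is a
finite convex function on `X` with bounded sublevel sets and a value at most `13 * B`.

This function is also continuous in `t`. By the open mapping theorem for the σ-compact group `G`,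
the space of distinct pairs carries the quotient topology of an orbit map, and along an orbit
continuity comes from equivariance (`continuous_sideDist_pairs`). Bounded sets in a proper CAT(0)
space have unique centers. Taking `R = 14 * B` leaves room for the strict inequality that makes the
sublevel sets, and therefore their centers, vary continuously (`continuous_isCenter`). Uniqueness
also makes the center map Φ equivariant.

A closed group of isometries of a proper space acts properly on it, and Φ pulls this properness back
to triples. For measures, a member of the space in question has three distinct points in its
support, while most of the mass of μ × μ × μ sits on triples whose center is in a bounded set. If `g
• μ` is close to such a measure, some triple of the second kind is moved near a fixed support
triple, which bounds the displacement of `g` (`exists_nhds_forall_dist_le`). So stabilizers are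
compact and orbits closed, and closed orbits in a second countable space give tameness. -/

theorem exists_comparison_triangle {a b c : ℝ} (ha : 0 ≤ a) (hb : 0 ≤ b) (hc : 0 ≤ c)
    (h1 : a ≤ b + c) (h2 : b ≤ a + c) (h3 : c ≤ a + b) :
    ∃ p q r : EuclideanSpace ℝ (Fin 2), dist p q = a ∧ dist q r = b ∧ dist p r = c := by
  rcases ha.eq_or_lt with rfl | ha'
  · have hbc : b = c := by linarith
    subst hbc
    refine ⟨0, 0, !₂[b, 0], by simp, ?_, ?_⟩ <;>
      simp [EuclideanSpace.dist_eq, Fin.sum_univ_two, Real.dist_eq, Real.sqrt_sq_eq_abs,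
        abs_of_nonneg hb]
  -- Law of cosines: `u` is the first coordinate of the third vertex when the side of length `a`
  -- lies on the axis. The triangle inequalities amount to `|u| ≤ c`.
  · set u : ℝ := (a ^ 2 + c ^ 2 - b ^ 2) / (2 * a) with hu
    have hua : 2 * a * u = a ^ 2 + c ^ 2 - b ^ 2 := by rw [hu]; field_simp
    have hle : u ^ 2 ≤ c ^ 2 := by
      have h4 : u ≤ c := by
        by_contra! h
        nlinarith [mul_pos ha' (sub_pos.2 h)]
      have h5 : -c ≤ u := by
        by_contra! h
        nlinarith [mul_pos ha' (sub_pos.2 h)]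
      exact sq_le_sq' h5 h4
    have hv : Real.sqrt (c ^ 2 - u ^ 2) ^ 2 = c ^ 2 - u ^ 2 := Real.sq_sqrt (by linarith)
    refine ⟨0, !₂[a, 0], !₂[u, Real.sqrt (c ^ 2 - u ^ 2)], ?_, ?_, ?_⟩
    · simp [EuclideanSpace.dist_eq, Fin.sum_univ_two, Real.dist_eq, Real.sqrt_sq_eq_abs,
        abs_of_nonneg ha]
    · rw [EuclideanSpace.dist_eq]
      conv_rhs => rw [← Real.sqrt_sq hb]
      congr 1
      simp only [Fin.sum_univ_two, Real.dist_eq, sq_abs]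
      simp only [Fin.isValue, Matrix.cons_val_zero, Matrix.cons_val_one,
        Matrix.cons_val_fin_one]
      nlinarith
    · rw [EuclideanSpace.dist_eq]
      conv_rhs => rw [← Real.sqrt_sq hc]
      congr 1
      simp only [Fin.sum_univ_two, Real.dist_eq, sq_abs]
      simp only [Fin.isValue, PiLp.zero_apply, Matrix.cons_val_zero,
        Matrix.cons_val_one, Matrix.cons_val_fin_one]
      nlinarith

/-- Stewart's identity, the Euclidean equality behind the Bruhat–Tits inequality. -/
theorem dist_lineMap_sq {E : Type*} [NormedAddCommGroup E] [InnerProductSpace ℝ E]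
    (p q r : E) (t : ℝ) :
    dist (AffineMap.lineMap q r t) p ^ 2 =
      (1 - t) * dist p q ^ 2 + t * dist p r ^ 2 - t * (1 - t) * dist q r ^ 2 := by
  have h1 : AffineMap.lineMap q r t - p = (1 - t) • (q - p) + t • (r - p) := by
    rw [AffineMap.lineMap_apply_module]
    module
  have h2 : dist q r = ‖(q - p) - (r - p)‖ := by rw [dist_eq_norm]; congr 1; abel
  rw [h2, dist_comm p q, dist_comm p r, dist_eq_norm, dist_eq_norm, dist_eq_norm, h1]
  generalize q - p = a, r - p = b
  rw [norm_add_sq_real, norm_sub_sq_real, norm_smul, norm_smul, inner_smul_left, inner_smul_right,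
    mul_pow, mul_pow, Real.norm_eq_abs, Real.norm_eq_abs, sq_abs, sq_abs]
  simp only [conj_trivial]
  ring

/-! ### Points on geodesic segments -/

section Between

variable {X : Type*} [MetricSpace X]

/-- `z` divides a geodesic segment from `x` to `y` in the ratio `t : 1 - t`. -/
def Between (x y : X) (t : ℝ) (z : X) : Prop :=
  dist x z = t * dist x y ∧ dist z y = (1 - t) * dist x y

theorem Between.add {x y z : X} {t : ℝ} (h : Between x y t z) :
    dist x z + dist z y = dist x y := by
  rw [h.1, h.2]; ring

theorem Between.symm {x y z : X} {t : ℝ} (h : Between x y t z) : Between y x (1 - t) z := by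
  refine ⟨?_, ?_⟩
  · rw [dist_comm y z, dist_comm y x, h.2]
  · rw [dist_comm z x, dist_comm y x, h.1]; ring

theorem IsCAT0.exists_between (hX : IsCAT0 X) (x y : X) {t : ℝ} (ht : t ∈ Icc (0 : ℝ) 1) :
    ∃ z, Between x y t z := by
  obtain ⟨γ, h0, h1, h⟩ := hX.geodesic x y
  have hd : (0 : ℝ) ≤ dist x y := dist_nonneg
  have htd : t * dist x y ∈ Icc 0 (dist x y) :=
    ⟨mul_nonneg ht.1 hd, mul_le_of_le_one_left hd ht.2⟩
  refine ⟨γ (t * dist x y), ?_, ?_⟩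
  · have e : dist x (γ (t * dist x y)) = dist (γ 0) (γ (t * dist x y)) := by rw [h0]
    rw [e, h 0 ⟨le_rfl, hd⟩ _ htd, zero_sub, abs_neg, abs_of_nonneg htd.1]
  · have e : dist (γ (t * dist x y)) y = dist (γ (t * dist x y)) (γ (dist x y)) := by rw [h1]
    rw [e, h _ htd _ ⟨hd, le_rfl⟩, abs_sub_comm, abs_of_nonneg (by linarith [htd.2])]
    ring

theorem between_of_add {x y z : X} (h : dist x z + dist z y = dist x y) :
    ∃ t ∈ Icc (0 : ℝ) 1, Between x y t z := by
  rcases eq_or_ne x y with rfl | hne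
  · have hz : dist x z = 0 := by
      have := dist_comm x z
      rw [dist_self] at h
      linarith
    exact ⟨0, by simp, by simp [Between, hz, dist_comm z x]⟩
  · have hd : 0 < dist x y := dist_pos.2 hne
    refine ⟨dist x z / dist x y, ⟨by positivity, ?_⟩, ?_, ?_⟩
    · rw [div_le_one hd]; linarith [dist_nonneg (x := z) (y := y)]
    · field_simp
    · field_simp; linarith

theorem exists_comparison (p q r : X) : ∃ p' q' r' : EuclideanSpace ℝ (Fin 2),
    dist p' q' = dist p q ∧ dist q' r' = dist q r ∧ dist p' r' = dist p r :=
  exists_comparison_triangle dist_nonneg dist_nonneg dist_nonneg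
    (by rw [dist_comm q r, add_comm]; exact dist_triangle _ _ _)
    (by rw [dist_comm p q]; exact dist_triangle _ _ _) (dist_triangle _ _ _)

/-- In the comparison triangle the two points are images of vertices under the homothety of ratio
`t` centered at the common vertex. -/
theorem IsCAT0.dist_le_of_between_left (hX : IsCAT0 X) {p q r x y : X} {t : ℝ}
    (ht : t ∈ Icc (0 : ℝ) 1) (hx : Between p q t x) (hy : Between p r t y) : dist x y ≤ t * dist q r := by
  obtain ⟨p', q', r', h1, h2, h3⟩ := exists_comparison p q r
  have key := hX.comparison p q r x y hx.add hy.add p' q' r'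
    (AffineMap.lineMap p' q' t) (AffineMap.lineMap p' r' t) h1 h2 h3
    (by rw [dist_left_lineMap, h1, hx.1, Real.norm_of_nonneg ht.1])
    (by rw [dist_lineMap_right, h1, hx.2, Real.norm_of_nonneg (sub_nonneg.2 ht.2)])
    (by rw [dist_left_lineMap, h3, hy.1, Real.norm_of_nonneg ht.1])
    (by rw [dist_lineMap_right, h3, hy.2, Real.norm_of_nonneg (sub_nonneg.2 ht.2)])
  refine key.trans_eq ?_
  have : AffineMap.lineMap p' q' t - AffineMap.lineMap p' r' t = t • (q' - r') := by
    rw [AffineMap.lineMap_apply_module, AffineMap.lineMap_apply_module]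
    module
  rw [dist_eq_norm, this, norm_smul, Real.norm_of_nonneg ht.1, ← dist_eq_norm, h2]

/-- The inequality of Bruhat and Tits. -/
theorem IsCAT0.dist_sq_le (hX : IsCAT0 X) {p q r z : X} {t : ℝ}
    (ht : t ∈ Icc (0 : ℝ) 1) (hz : Between q r t z) :
    dist z p ^ 2 ≤
      (1 - t) * dist p q ^ 2 + t * dist p r ^ 2 - t * (1 - t) * dist q r ^ 2 := by
  obtain ⟨q', r', p', h1, h2, h3⟩ := exists_comparison q r p
  -- The second comparison point is the vertex `p` itself, a degenerate point of the side from `q`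
  -- to `p`.
  have key := hX.comparison q r p z p hz.add (by simp) q' r' p'
    (AffineMap.lineMap q' r' t) p' h1 h2 h3
    (by rw [dist_left_lineMap, h1, hz.1, Real.norm_of_nonneg ht.1])
    (by rw [dist_lineMap_right, h1, hz.2, Real.norm_of_nonneg (sub_nonneg.2 ht.2)])
    h3 (by simp)
  have := dist_lineMap_sq p' q' r' t
  rw [dist_comm p' q', dist_comm p' r', h1, h2, h3] at this
  rw [dist_comm p q, dist_comm p r, dist_comm r p] at *
  nlinarith [dist_nonneg (x := z) (y := p)]

/-- Convexity of the metric: the diagonal from `x` to `y'` cuts the quadrilateral into two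
triangles, each handled by the case of a common vertex. -/
theorem IsCAT0.dist_le_of_between (hX : IsCAT0 X) {x y x' y' z z' : X} {t : ℝ}
    (ht : t ∈ Icc (0 : ℝ) 1) (hz : Between x y t z) (hz' : Between x' y' t z') :
    dist z z' ≤ (1 - t) * dist x x' + t * dist y y' := by
  obtain ⟨w, hw⟩ := hX.exists_between x y' ht
  have ht' : 1 - t ∈ Icc (0 : ℝ) 1 := ⟨by linarith [ht.2], by linarith [ht.1]⟩
  have h1 := hX.dist_le_of_between_left ht hz hw
  have h2 := hX.dist_le_of_between_left ht' hw.symm hz'.symm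
  linarith [dist_triangle z w z']

end Between

/-! ### Geodesically convex functions -/

section Convex

variable {X : Type*} [MetricSpace X]

/-- Functions that are convex along geodesic segments. -/
def GeodesicallyConvex (f : X → ℝ) : Prop :=
  ∀ ⦃x y z : X⦄ ⦃t : ℝ⦄, t ∈ Icc (0 : ℝ) 1 → Between x y t z → f z ≤ (1 - t) * f x + t * f y

theorem GeodesicallyConvex.le_max {f : X → ℝ} (hf : GeodesicallyConvex f) {x y z : X} {t : ℝ}
    (ht : t ∈ Icc (0 : ℝ) 1) (hz : Between x y t z) : f z ≤ max (f x) (f y) := by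
  refine (hf ht hz).trans ?_
  nlinarith [le_max_left (f x) (f y), le_max_right (f x) (f y), ht.1, ht.2]

theorem GeodesicLine.dist_eq (γ : GeodesicLine X) (s t : ℝ) : dist (γ s) (γ t) = |s - t| := by
  rw [γ.isometry.dist_eq, Real.dist_eq]

theorem GeodesicRay.dist_eq (c : GeodesicRay X) (s t : ℝ≥0) :
    dist (c s) (c t) = |(s : ℝ) - t| := by
  rw [c.isometry.dist_eq, NNReal.dist_eq]

theorem GeodesicLine.between (γ : GeodesicLine X) (a b : ℝ) {t : ℝ} (ht : t ∈ Icc (0 : ℝ) 1) :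
    Between (γ a) (γ b) t (γ ((1 - t) * a + t * b)) := by
  refine ⟨?_, ?_⟩
  · rw [γ.dist_eq, γ.dist_eq, ← abs_of_nonneg ht.1, ← abs_mul, abs_of_nonneg ht.1]
    ring_nf
  · rw [γ.dist_eq, γ.dist_eq, ← abs_of_nonneg (sub_nonneg.2 ht.2), ← abs_mul,
      abs_of_nonneg (sub_nonneg.2 ht.2)]
    ring_nf

theorem GeodesicRay.between (c : GeodesicRay X) (b : ℝ≥0) {t : ℝ≥0} (ht : t ≤ 1) :
    Between (c 0) (c b) t (c (t * b)) := by
  have ht' : (t : ℝ) ≤ 1 := by exact_mod_cast ht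
  refine ⟨?_, ?_⟩
  · rw [c.dist_eq, c.dist_eq]
    simp [abs_mul]
  · rw [c.dist_eq, c.dist_eq]
    push_cast
    rw [abs_sub_comm, zero_sub, abs_neg, abs_of_nonneg b.coe_nonneg, abs_of_nonneg]
    · ring
    · nlinarith [b.coe_nonneg]

theorem GeodesicLine.isClosed_range (γ : GeodesicLine X) : IsClosed (range γ) :=
  γ.isometry.isClosedEmbedding.isClosed_range

theorem GeodesicLine.exists_infDist [ProperSpace X] (γ : GeodesicLine X) (x : X) :
    ∃ s, Metric.infDist x (range γ) = dist x (γ s) := by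
  obtain ⟨_, ⟨s, rfl⟩, h⟩ := γ.isClosed_range.exists_infDist_eq_dist (range_nonempty _) x
  exact ⟨s, h⟩

theorem GeodesicLine.infDist_le (γ : GeodesicLine X) (x : X) (s : ℝ) :
    Metric.infDist x (range γ) ≤ dist x (γ s) := Metric.infDist_le_dist_of_mem ⟨s, rfl⟩

/-- The segment between the feet of `x` and `y` lies on `γ`, so convexity of the metric compares `z`
with a point of `γ`. -/
theorem IsCAT0.geodesicallyConvex_infDist [ProperSpace X] (hX : IsCAT0 X) (γ : GeodesicLine X) :
    GeodesicallyConvex fun x => Metric.infDist x (range γ) := by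
  intro x y z t ht hz
  obtain ⟨a, ha⟩ := γ.exists_infDist x
  obtain ⟨b, hb⟩ := γ.exists_infDist y
  simp only [ha, hb]
  exact (γ.infDist_le z _).trans (hX.dist_le_of_between ht hz (γ.between a b ht))

theorem GeodesicallyConvex.convexOn_line {f : X → ℝ} (hf : GeodesicallyConvex f)
    (γ : GeodesicLine X) : ConvexOn ℝ univ fun t => f (γ t) := by
  refine ⟨convex_univ, fun a _ b _ u v hu hv huv => ?_⟩
  have hu' : u = 1 - v := by linarith
  subst hu'
  simpa using hf (t := v) ⟨hv, by linarith⟩ (γ.between a b ⟨hv, by linarith⟩)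

/-- A convex function with two different values grows at least linearly beyond the larger one, hence
exceeds every bound. -/
theorem eq_of_convexOn_of_le {f : ℝ → ℝ} (hf : ConvexOn ℝ univ f) {C : ℝ} (hC : ∀ t, f t ≤ C)
    (s t : ℝ) : f s = f t := by
  have key : ∀ s t : ℝ, f s ≤ f t := by
    intro s t
    by_contra! hlt
    obtain ⟨n, hn⟩ := exists_nat_gt ((C - f t) / (f s - f t))
    have hn' : C - f t < n * (f s - f t) := by
      rwa [div_lt_iff₀ (sub_pos.2 hlt)] at hn
    have hn0 : (0 : ℝ) < n + 1 := by positivity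
    have h1 := hf.2 (mem_univ t) (mem_univ (t + (n + 1) * (s - t)))
      (show (0 : ℝ) ≤ n / (n + 1) by positivity) (show (0 : ℝ) ≤ 1 / (n + 1) by positivity)
      (by field_simp)
    have h2 : (n / (n + 1) : ℝ) • t + (1 / (n + 1) : ℝ) • (t + (n + 1) * (s - t)) = s := by
      simp only [smul_eq_mul]; field_simp; ring
    rw [h2] at h1
    simp only [smul_eq_mul] at h1
    have h3 := hC (t + (n + 1) * (s - t))
    have h4 : f s * (n + 1) ≤ n * f t + C := by
      have : f s * (n + 1) ≤
          (n / (n + 1) * f t + 1 / (n + 1) * f (t + (n + 1) * (s - t))) * (n + 1) :=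
        mul_le_mul_of_nonneg_right h1 hn0.le
      refine this.trans ?_
      rw [add_mul]
      have e1 : (n / (n + 1) * f t * (n + 1) : ℝ) = n * f t := by field_simp
      have e2 : (1 / (n + 1) * f (t + (n + 1) * (s - t)) * (n + 1) : ℝ)
        = f (t + (n + 1) * (s - t)) := by field_simp
      rw [e1, e2]; linarith
    nlinarith
  exact le_antisymm (key s t) (key t s)

end Convex

/-! ### Centers of bounded sets -/

section Center

variable {X : Type*} [MetricSpace X]

/-- The radius of the smallest ball about `x` containing `K` is 1-Lipschitz in `x` and tends to
infinity, so it attains its minimum. -/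
theorem IsCAT0.exists_isCenter [ProperSpace X] {K : Set X} (hK : Bornology.IsBounded K)
    (hne : K.Nonempty) : ∃ x, IsCenter K x := by
  obtain ⟨k, hk⟩ := hne
  obtain ⟨D, hD⟩ := hK.subset_closedBall k
  have hbdd : ∀ x, BddAbove ((fun y => dist y x) '' K) := by
    intro x
    refine ⟨D + dist k x, ?_⟩
    rintro _ ⟨y, hy, rfl⟩
    have := hD hy
    rw [Metric.mem_closedBall] at this
    exact (dist_triangle y k x).trans (by linarith)
  set r : X → ℝ := fun x => sSup ((fun y => dist y x) '' K) with hr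
  have hle : ∀ x, ∀ y ∈ K, dist y x ≤ r x := fun x y hy => le_csSup (hbdd x) ⟨y, hy, rfl⟩
  have hcont : Continuous r := by
    refine LipschitzWith.continuous (K := 1) (LipschitzWith.of_le_add fun x y => ?_)
    refine csSup_le ⟨_, ⟨k, hk, rfl⟩⟩ ?_
    rintro _ ⟨z, hz, rfl⟩
    have := hle y z hz
    have := dist_triangle z y x
    rw [dist_comm y x] at this
    linarith
  have hlim : Tendsto r (cocompact X) atTop :=
    tendsto_atTop_mono (fun x => (hle x k hk)) (by
      simpa [dist_comm] using tendsto_dist_right_cocompact_atTop k)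
  have : Nonempty X := ⟨k⟩
  obtain ⟨x, hx⟩ := hcont.exists_forall_le hlim
  refine ⟨x, fun y s hs z hz => ?_⟩
  refine (hle x z hz).trans ((hx y).trans (csSup_le ⟨_, ⟨k, hk, rfl⟩⟩ ?_))
  rintro _ ⟨w, hw, rfl⟩
  exact hs hw

/-- By the Bruhat–Tits inequality the midpoint of two distinct centers would be the center of a
strictly smaller ball containing `K`. -/
theorem IsCAT0.isCenter_unique (hX : IsCAT0 X) {K : Set X} (hK : Bornology.IsBounded K)
    (hne : K.Nonempty) {x y : X} (hx : IsCenter K x) (hy : IsCenter K y) : x = y := by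
  by_contra hxy
  have hd : 0 < dist x y := dist_pos.2 hxy
  obtain ⟨k, hk⟩ := hne
  obtain ⟨D, hD⟩ := hK.subset_closedBall x
  have hbdd : BddAbove ((fun z => dist z x) '' K) := by
    refine ⟨D, ?_⟩
    rintro _ ⟨z, hz, rfl⟩
    exact hD hz
  set r := sSup ((fun z => dist z x) '' K)
  have hr : K ⊆ Metric.closedBall x r := fun z hz => le_csSup hbdd ⟨z, hz, rfl⟩
  have hr0 : 0 ≤ r := dist_nonneg.trans (hr hk)
  have hr' : K ⊆ Metric.closedBall y r := hy x r hr
  have h2 : (1 / 2 : ℝ) ∈ Icc (0 : ℝ) 1 := by norm_num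
  obtain ⟨m, hm⟩ := hX.exists_between x y h2
  have hball : K ⊆ Metric.closedBall m (Real.sqrt (r ^ 2 - dist x y ^ 2 / 4)) := by
    intro z hz
    have e := hX.dist_sq_le (p := z) h2 hm
    have e1 : dist z x ^ 2 ≤ r ^ 2 := pow_le_pow_left₀ dist_nonneg (hr hz) 2
    have e2 : dist z y ^ 2 ≤ r ^ 2 := pow_le_pow_left₀ dist_nonneg (hr' hz) 2
    rw [Metric.mem_closedBall, dist_comm]
    exact Real.le_sqrt_of_sq_le (by linarith)
  have hsub := hx m _ hball
  have hrle : r ≤ Real.sqrt (r ^ 2 - dist x y ^ 2 / 4) := by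
    refine csSup_le ⟨_, ⟨k, hk, rfl⟩⟩ ?_
    rintro _ ⟨z, hz, rfl⟩
    exact hsub hz
  have hlt : Real.sqrt (r ^ 2 - dist x y ^ 2 / 4) ≤ Real.sqrt (r ^ 2) :=
    Real.sqrt_le_sqrt (by linarith [sq_nonneg (dist x y)])
  -- Excludes the default value 0 of `Real.sqrt` at negative numbers: it would force `r ≤ 0`,
  -- although `dist x y ≤ 2 * r`.
  have hnn : 0 ≤ r ^ 2 - dist x y ^ 2 / 4 := by
    by_contra! hneg
    rw [Real.sqrt_eq_zero_of_nonpos hneg.le] at hrle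
    have : dist x y ≤ 2 * r := by
      have h3 : dist k x ≤ r := hr hk
      have h4 : dist k y ≤ r := hr' hk
      rw [dist_comm] at h3
      linarith [dist_triangle x k y]
    linarith
  have := Real.sq_sqrt hnn
  nlinarith [Real.sqrt_nonneg (r ^ 2 - dist x y ^ 2 / 4)]

end Center

/-! ### Asymptotic rays -/

section Rays

variable {X : Type*} [MetricSpace X]

theorem GeodesicRay.ext' {c c' : GeodesicRay X} (h : ∀ t, c t = c' t) : c = c' := by
  cases c; cases c'
  congr
  exact funext h

theorem GeodesicRay.between_of_le (c : GeodesicRay X) {t s : ℝ≥0} (hts : t ≤ s) (hs : 0 < s) :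
    Between (c 0) (c s) ((t : ℝ) / s) (c t) := by
  have h : t / s ≤ 1 := div_le_one_of_le₀ hts (zero_le)
  have := c.between s h
  rwa [div_mul_cancel₀ _ hs.ne', NNReal.coe_div] at this

theorem div_mem_Icc_of_le {t s : ℝ≥0} (hts : t ≤ s) : (t : ℝ) / s ∈ Icc (0 : ℝ) 1 :=
  ⟨by positivity, div_le_one_of_le₀ (by exact_mod_cast hts) s.coe_nonneg⟩

/-- Convexity on `[0, s]` bounds the distance at `t` by a combination in which the asymptotic bound
`C` has weight `t / s`; let `s` tend to infinity. -/
theorem IsCAT0.dist_ray_le (hX : IsCAT0 X) {c c' : GeodesicRay X} (h : c ≈ c') (t : ℝ≥0) :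
    dist (c t) (c' t) ≤ dist (c 0) (c' 0) := by
  obtain ⟨C, hC⟩ := h
  have hlim : Tendsto (fun s : ℝ≥0 => (1 - (t : ℝ) / s) * dist (c 0) (c' 0) + t / s * C) atTop
      (𝓝 ((1 - 0) * dist (c 0) (c' 0) + 0 * C)) := by
    have h0 : Tendsto (fun s : ℝ≥0 => (t : ℝ) / s) atTop (𝓝 0) :=
      tendsto_const_nhds.div_atTop (NNReal.tendsto_coe_atTop.2 tendsto_id)
    exact ((tendsto_const_nhds.sub h0).mul_const _).add (h0.mul_const _)
  rw [sub_zero, one_mul, zero_mul, add_zero] at hlim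
  refine ge_of_tendsto hlim ?_
  filter_upwards [eventually_ge_atTop t, eventually_gt_atTop 0] with s hs hs0
  refine (hX.dist_le_of_between (div_mem_Icc_of_le hs) (c.between_of_le hs hs0)
    (c'.between_of_le hs hs0)).trans ?_
  gcongr
  exact hC s

theorem IsCAT0.ray_unique (hX : IsCAT0 X) {c c' : GeodesicRay X} (h : c ≈ c') (h0 : c 0 = c' 0) :
    c = c' := by
  refine GeodesicRay.ext' fun t => dist_le_zero.1 ((hX.dist_ray_le h t).trans ?_)
  rw [h0, dist_self]

theorem exists_tendsto_of_dist_le [ProperSpace X] {ι : Type*} (U : Ultrafilter ι) {f : ι → X}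
    {x : X} {C : ℝ} (h : ∀ᶠ i in U, dist (f i) x ≤ C) : ∃ y, Tendsto f U (𝓝 y) := by
  obtain ⟨y, -, hy⟩ := (isCompact_closedBall x C).ultrafilter_le_nhds (U.map f)
    (le_principal_iff.2 h)
  exact ⟨y, hy⟩

/-- Limits of paths that are geodesic on longer and longer intervals are rays. -/
theorem exists_ray_of_eventually_isometry [ProperSpace X] {ι : Type*} (U : Ultrafilter ι)
    {σ : ι → ℝ≥0 → X} {x : X} (h0 : Tendsto (fun i => σ i 0) U (𝓝 x))
    (h : ∀ s t, ∀ᶠ i in U, dist (σ i s) (σ i t) = |(s : ℝ) - t|) :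
    ∃ c : GeodesicRay X, c 0 = x ∧ ∀ t, Tendsto (fun i => σ i t) U (𝓝 (c t)) := by
  have hex : ∀ t, ∃ y, Tendsto (fun i => σ i t) U (𝓝 y) := by
    intro t
    refine exists_tendsto_of_dist_le U (x := x) (C := t + 1) ?_
    filter_upwards [h t 0, h0.eventually (Metric.ball_mem_nhds x one_pos)] with i hi hi'
    rw [NNReal.coe_zero, sub_zero, abs_of_nonneg t.coe_nonneg] at hi
    have := dist_triangle (σ i t) (σ i 0) x
    have hi'' : dist (σ i 0) x < 1 := hi'
    linarith
  choose f hf using hex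
  have hiso : Isometry f := by
    refine Isometry.of_dist_eq fun s t => ?_
    rw [NNReal.dist_eq]
    exact tendsto_nhds_unique ((hf s).dist (hf t))
      (tendsto_const_nhds.congr' ((h s t).mono fun i hi => hi.symm))
  exact ⟨⟨f, hiso⟩, tendsto_nhds_unique (hf 0) h0, hf⟩

theorem exists_ray_limit [ProperSpace X] {ι : Type*} (U : Ultrafilter ι)
    {c : ι → GeodesicRay X} {x : X} (h0 : Tendsto (fun i => c i 0) U (𝓝 x)) :
    ∃ c' : GeodesicRay X, c' 0 = x ∧ ∀ t, Tendsto (fun i => c i t) U (𝓝 (c' t)) :=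
  exists_ray_of_eventually_isometry U h0 fun s t =>
    Eventually.of_forall fun i => (c i).dist_eq s t

theorem between_of_dist_eq {x z p : X} {r : ℝ} (h1 : dist x p = r)
    (h2 : dist p z = dist x z - r) (hz : 0 < dist x z) : Between x z (r / dist x z) p := by
  refine ⟨?_, ?_⟩
  · field_simp; exact h1
  · field_simp; exact h2

/-- Segments from the origin of a ray to points close to the ray stay close to the ray. -/
theorem IsCAT0.dist_segment_ray_le (hX : IsCAT0 X) {c' : GeodesicRay X} {D : ℝ} {s r : ℝ≥0}
    {p z : X} (hz : dist z (c' s) ≤ D) (hr : (r : ℝ) ≤ dist (c' 0) z) (h0 : 0 < dist (c' 0) z)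
    (h1 : dist (c' 0) p = r) (h2 : dist p z = dist (c' 0) z - r) :
    dist p (c' r) ≤ 2 * r * D / dist (c' 0) z := by
  set ℓ := dist (c' 0) z with hℓ
  have ht : (r : ℝ) / ℓ ∈ Icc (0 : ℝ) 1 := ⟨by positivity, (div_le_one h0).2 hr⟩
  let t : ℝ≥0 := ⟨r / ℓ, ht.1⟩
  have hb := c'.between s (t := t) (by exact ht.2)
  have e1 := hX.dist_le_of_between_left (t := r / ℓ) ht (between_of_dist_eq h1 h2 h0) hb
  have e2 : dist (c' (t * s)) (c' r) ≤ r / ℓ * D := by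
    rw [c'.dist_eq]
    have e3 : ((t * s : ℝ≥0) : ℝ) - r = r / ℓ * (s - ℓ) := by
      push_cast
      change r / ℓ * (s : ℝ) - r = _
      field_simp
    have e4 : |(s : ℝ) - ℓ| ≤ D := by
      have := abs_dist_sub_le (c' s) z (c' 0)
      rw [dist_comm, c'.dist_eq, NNReal.coe_zero, zero_sub, abs_neg, abs_of_nonneg s.coe_nonneg,
        dist_comm z (c' 0)] at this
      rw [dist_comm] at hz
      exact this.trans hz
    rw [e3, abs_mul, abs_of_nonneg ht.1]
    exact mul_le_mul_of_nonneg_left e4 ht.1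
  have e5 : r / ℓ * dist z (c' s) ≤ r / ℓ * D := mul_le_mul_of_nonneg_left hz ht.1
  have e6 : 2 * r * D / ℓ = r / ℓ * D + r / ℓ * D := by ring
  rw [e6]
  linarith [dist_triangle p (c' (t * s)) (c' r)]

/-- The segments from `x` to `c n` converge along an ultrafilter. They stay near `c`, because moving
the origin and adjusting the parametrization each cost at most `D`. -/
theorem IsCAT0.exists_ray [ProperSpace X] (hX : IsCAT0 X) (x : X) (c : GeodesicRay X) :
    ∃ c' : GeodesicRay X, c' 0 = x ∧ c' ≈ c := by
  choose γ hγ0 hγ1 hγ using fun n : ℕ => hX.geodesic x (c n)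
  set D := dist x (c 0)
  have hℓ : Tendsto (fun n : ℕ => dist x (c n)) atTop atTop := by
    refine tendsto_atTop_mono (f := fun n : ℕ => (n : ℝ) - D) (fun n => ?_)
      (tendsto_atTop_add_const_right _ _ tendsto_natCast_atTop_atTop)
    have h1 := c.dist_eq 0 n
    rw [NNReal.coe_zero, zero_sub, abs_neg, NNReal.coe_natCast, Nat.abs_cast] at h1
    have := dist_triangle (c 0) x (c n)
    rw [dist_comm (c 0) x] at this
    simp only [D]
    linarith
  let U : Ultrafilter ℕ := hyperfilter ℕ
  have hU : (U : Filter ℕ) ≤ atTop := Nat.hyperfilter_le_atTop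
  obtain ⟨c', hc0, hc'⟩ := exists_ray_of_eventually_isometry U (x := x)
    (σ := fun n t => γ n t) (by simp [hγ0]) (by
      intro s t
      filter_upwards [hU (hℓ.eventually_ge_atTop s), hU (hℓ.eventually_ge_atTop t)] with n hs ht
      exact hγ n s ⟨s.coe_nonneg, hs⟩ t ⟨t.coe_nonneg, ht⟩)
  refine ⟨c', hc0, 2 * D, fun t => ?_⟩
  refine le_of_tendsto ((hc' t).dist tendsto_const_nhds) ?_
  filter_upwards [hU (hℓ.eventually_ge_atTop t), hU (hℓ.eventually_gt_atTop 0)] with n hn h0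
  set ℓ := dist x (c n) with hℓdef
  have htℓ : (t : ℝ) / ℓ ∈ Icc (0 : ℝ) 1 := ⟨by positivity, (div_le_one h0).2 hn⟩
  have hd0 : dist x (γ n t) = t := by
    conv_lhs => rw [← hγ0 n]
    rw [hγ n 0 ⟨le_rfl, h0.le⟩ t ⟨t.coe_nonneg, hn⟩, zero_sub, abs_neg,
      abs_of_nonneg t.coe_nonneg]
  have hd1 : dist (γ n t) (c n) = ℓ - t := by
    conv_lhs => rw [← hγ1 n]
    rw [hγ n t ⟨t.coe_nonneg, hn⟩ _ ⟨h0.le, le_rfl⟩, abs_sub_comm, abs_of_nonneg (by linarith)]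
  let q : ℝ≥0 := ⟨t / ℓ, htℓ.1⟩
  have e1 := hX.dist_le_of_between htℓ (between_of_dist_eq hd0 hd1 h0)
    (c.between n (t := q) (by exact htℓ.2))
  have e4 : |(n : ℝ) - ℓ| ≤ D := by
    have := abs_dist_sub_le (c 0) x (c n)
    rwa [c.dist_eq, NNReal.coe_zero, zero_sub, abs_neg, NNReal.coe_natCast, Nat.abs_cast,
      dist_comm (c 0) x] at this
  have e2 : dist (c (q * n)) (c t) ≤ t / ℓ * D := by
    rw [c.dist_eq]
    have e3 : ((q * n : ℝ≥0) : ℝ) - t = t / ℓ * (n - ℓ) := by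
      push_cast
      change t / ℓ * (n : ℝ) - t = _
      field_simp
    rw [e3, abs_mul, abs_of_nonneg htℓ.1]
    exact mul_le_mul_of_nonneg_left e4 htℓ.1
  have hD : 0 ≤ D := dist_nonneg
  rw [dist_self, mul_zero, add_zero] at e1
  have := dist_triangle (γ n t) (c (q * n)) (c t)
  change _ ≤ (1 - t / ℓ) * D at e1
  nlinarith

theorem IsCAT0.exists_ray_endpoint [ProperSpace X] (hX : IsCAT0 X) (x : X) (ξ : Boundary X) :
    ∃ c : GeodesicRay X, c 0 = x ∧ c.endpoint = ξ := by
  induction ξ using Quotient.inductionOn with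
  | h c =>
    obtain ⟨c', h0, h⟩ := hX.exists_ray x c
    exact ⟨c', h0, Quotient.sound h⟩

/-- The ray from `x` to `ξ`. -/
noncomputable def IsCAT0.ray [ProperSpace X] (hX : IsCAT0 X) (x : X) (ξ : Boundary X) :
    GeodesicRay X := (hX.exists_ray_endpoint x ξ).choose

theorem endpoint_eq_iff {c c' : GeodesicRay X} : c.endpoint = c'.endpoint ↔ c ≈ c' :=
  Quotient.eq

variable [ProperSpace X]

theorem IsCAT0.ray_zero (hX : IsCAT0 X) (x : X) (ξ : Boundary X) : hX.ray x ξ 0 = x :=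
  (hX.exists_ray_endpoint x ξ).choose_spec.1

theorem IsCAT0.ray_endpoint (hX : IsCAT0 X) (x : X) (ξ : Boundary X) :
    (hX.ray x ξ).endpoint = ξ := (hX.exists_ray_endpoint x ξ).choose_spec.2

theorem IsCAT0.eq_ray (hX : IsCAT0 X) (c : GeodesicRay X) : c = hX.ray (c 0) c.endpoint :=
  hX.ray_unique (endpoint_eq_iff.1 (hX.ray_endpoint _ _).symm) (hX.ray_zero _ _).symm

/-- Pointwise convergence of rays implies pointwise convergence of asymptotic rays whose origins
converge. -/
theorem IsCAT0.tendsto_asymptotic_ray (hX : IsCAT0 X) {ι : Type*} {F : Filter ι}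
    {c c' : ι → GeodesicRay X} {d d' : GeodesicRay X}
    (hc : ∀ t, Tendsto (fun i => c i t) F (𝓝 (d t))) (hasymp : ∀ i, c i ≈ c' i) (hd : d ≈ d')
    (h0 : Tendsto (fun i => c' i 0) F (𝓝 (d' 0))) (t : ℝ≥0) :
    Tendsto (fun i => c' i t) F (𝓝 (d' t)) := by
  rw [tendsto_iff_ultrafilter]
  intro U hU
  obtain ⟨e, he0, he⟩ := exists_ray_limit U (h0.mono_left hU)
  -- Distances of asymptotic rays are bounded by those of their origins, and this bound survives the
  -- limit; uniqueness then identifies `e` with `d'`.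
  have hed : d ≈ e := by
    refine ⟨dist (d 0) (d' 0), fun s => ?_⟩
    refine le_of_tendsto_of_tendsto (((hc s).mono_left hU).dist (he s))
      (((hc 0).mono_left hU).dist (h0.mono_left hU)) (Eventually.of_forall fun i => ?_)
    exact hX.dist_ray_le (hasymp i) s
  have : e = d' := hX.ray_unique (Setoid.trans (Setoid.symm hed) hd) he0
  rw [← this]
  exact he t

/-! ### The topology of the boundary -/

theorem IsCAT0.ideal_mem_coneNhd (hX : IsCAT0 X) (c : GeodesicRay X) (r : ℝ≥0) (ε : ℝ)
    (ξ : Boundary X) :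
    Bordification.ideal ξ ∈ coneNhd c r ε ↔ dist (hX.ray (c 0) ξ r) (c r) < ε := by
  constructor
  · rintro (⟨x, hx, -⟩ | ⟨c', h, h0, hr⟩)
    · cases hx
    · obtain rfl : ξ = c'.endpoint := by injection h
      rwa [← h0, ← hX.eq_ray c']
  · intro h
    exact Or.inr ⟨hX.ray (c 0) ξ, by rw [hX.ray_endpoint], hX.ray_zero _ _, h⟩

/-- The cone topology on the boundary is that of pointwise convergence of rays from a single origin.
Basic neighbourhoods with another origin are open in it because `tendsto_asymptotic_ray` allows a
change of origin. -/
theorem IsCAT0.isInducing_ray (hX : IsCAT0 X) (x : X) :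
    IsInducing fun (ξ : Boundary X) (t : ℝ≥0) => hX.ray x ξ t := by
  refine ⟨le_antisymm ?_ ?_⟩
  · rw [← continuous_iff_le_induced]
    refine continuous_pi fun t => continuous_iff_continuousAt.2 fun ξ => ?_
    rw [ContinuousAt, Metric.tendsto_nhds]
    intro ε hε
    rcases eq_or_ne t 0 with rfl | ht
    · simp [hX.ray_zero, hε]
    · have hopen : IsOpen (coneNhd (hX.ray x ξ) t ε) :=
        TopologicalSpace.isOpen_generateFrom_of_mem
          (Or.inr ⟨_, t, ε, pos_iff_ne_zero.2 ht, hε, rfl⟩)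
      have hmem : ξ ∈ Bordification.ideal ⁻¹' coneNhd (hX.ray x ξ) t ε := by
        rw [mem_preimage, hX.ideal_mem_coneNhd, hX.ray_zero, dist_self]
        exact hε
      filter_upwards [(hopen.preimage continuous_induced_dom).mem_nhds hmem] with η hη
      rwa [mem_preimage, hX.ideal_mem_coneNhd, hX.ray_zero] at hη
  · set τ : TopologicalSpace (Boundary X) :=
      TopologicalSpace.induced (fun ξ t => hX.ray x ξ t) inferInstance with hτ
    change τ ≤ TopologicalSpace.induced Bordification.ideal inferInstance
    rw [← continuous_iff_le_induced]
    refine continuous_generateFrom_iff.2 ?_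
    rintro U (⟨V, hV, rfl⟩ | ⟨c, r, ε, hr, hε, rfl⟩)
    · have : Bordification.ideal ⁻¹' (Bordification.point '' V) = ∅ := by
        ext ξ; simp
      rw [this]
      exact isOpen_empty
    · have hcont : Continuous fun ξ => hX.ray (c 0) ξ r := by
        refine continuous_iff_continuousAt.2 fun ξ => ?_
        refine hX.tendsto_asymptotic_ray (c := fun η => hX.ray x η) (d := hX.ray x ξ) ?_ ?_ ?_ ?_ r
        · intro t
          have h1 : Continuous fun (η : Boundary X) (t : ℝ≥0) => hX.ray x η t :=
            continuous_induced_dom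
          exact ((continuous_apply t).comp h1).continuousAt
        · intro η
          rw [← endpoint_eq_iff, hX.ray_endpoint, hX.ray_endpoint]
        · rw [← endpoint_eq_iff, hX.ray_endpoint, hX.ray_endpoint]
        · simp only [hX.ray_zero]
          exact tendsto_const_nhds
      have : Bordification.ideal ⁻¹' coneNhd c r ε
          = (fun ξ => hX.ray (c 0) ξ r) ⁻¹' Metric.ball (c r) ε := by
        ext ξ
        exact hX.ideal_mem_coneNhd c r ε ξ
      rw [this]
      exact Metric.isOpen_ball.preimage hcont

theorem IsCAT0.tendsto_boundary_iff (hX : IsCAT0 X) (x : X) {ι : Type*} {F : Filter ι}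
    {f : ι → Boundary X} {ξ : Boundary X} :
    Tendsto f F (𝓝 ξ) ↔ ∀ t, Tendsto (fun i => hX.ray x (f i) t) F (𝓝 (hX.ray x ξ t)) := by
  rw [(hX.isInducing_ray x).tendsto_nhds_iff, tendsto_pi_nhds]
  rfl

theorem IsCAT0.continuous_ray (hX : IsCAT0 X) (x : X) (t : ℝ≥0) :
    Continuous fun ξ => hX.ray x ξ t :=
  (continuous_apply t).comp (hX.isInducing_ray x).continuous

/-- Integer times suffice, since a ray up to time `n` is determined by its origin and its point at
time `n`. Thus the boundary embeds into a countable power of `X`, which yields metrizability. -/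
theorem IsCAT0.ray_nat_injective (hX : IsCAT0 X) (x : X) :
    Function.Injective fun (ξ : Boundary X) (n : ℕ) => hX.ray x ξ n := by
  intro ξ η h
  rw [← hX.ray_endpoint x ξ, ← hX.ray_endpoint x η, endpoint_eq_iff]
  refine ⟨0, fun t => ?_⟩
  obtain ⟨n, hn⟩ := exists_nat_gt t
  have hn0 : (0 : ℝ≥0) < n := lt_of_le_of_lt (zero_le) hn
  have h1 := (hX.ray x ξ).between_of_le hn.le hn0
  have h2 := (hX.ray x η).between_of_le hn.le hn0
  have h3 : hX.ray x ξ n = hX.ray x η n := congrFun h n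
  have := hX.dist_le_of_between (div_mem_Icc_of_le hn.le) h1 h2
  rwa [h3, hX.ray_zero, hX.ray_zero, dist_self, dist_self, mul_zero, mul_zero, add_zero] at this

theorem IsCAT0.compactSpace_boundary [Nonempty X] (hX : IsCAT0 X) : CompactSpace (Boundary X) := by
  obtain ⟨x⟩ := ‹Nonempty X›
  refine ⟨isCompact_iff_ultrafilter_le_nhds.2 fun U _ => ?_⟩
  obtain ⟨c, h0, hc⟩ := exists_ray_limit U (c := fun ξ => hX.ray x ξ) (x := x)
    (by simpa only [hX.ray_zero] using tendsto_const_nhds)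
  refine ⟨c.endpoint, mem_univ _, ?_⟩
  have : Tendsto id (U : Filter (Boundary X)) (𝓝 c.endpoint) := by
    rw [hX.tendsto_boundary_iff x]
    intro t
    rw [← h0, ← hX.eq_ray c, h0]
    exact hc t
  exact this

theorem IsCAT0.isClosedEmbedding_ray_nat [Nonempty X] (hX : IsCAT0 X) (x : X) :
    IsClosedEmbedding fun (ξ : Boundary X) (n : ℕ) => hX.ray x ξ n := by
  have := hX.compactSpace_boundary
  have hc : Continuous fun (ξ : Boundary X) (n : ℕ) => hX.ray x ξ n :=
    continuous_pi fun n => hX.continuous_ray x n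
  exact hc.isClosedEmbedding (hX.ray_nat_injective x)

theorem IsCAT0.metrizableSpace_boundary [Nonempty X] (hX : IsCAT0 X) :
    TopologicalSpace.MetrizableSpace (Boundary X) := by
  obtain ⟨x⟩ := ‹Nonempty X›
  have : Nonempty X := ⟨x⟩
  exact (hX.isClosedEmbedding_ray_nat x).isEmbedding.metrizableSpace

end Rays

/-! ### The topological group of isometries -/

section Iso

variable {X : Type*} [MetricSpace X]

theorem continuous_iso_apply (x : X) : Continuous fun g : X ≃ᵢ X => g x := by
  have h : Continuous fun g : X ≃ᵢ X => (⟨g, g.continuous⟩ : C(X, X)) := continuous_induced_dom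
  exact (continuous_eval_const (F := C(X, X)) x).comp h

/-- The compact open topology on isometries is the topology of pointwise convergence. -/
theorem tendsto_iso_iff {ι : Type*} {F : Filter ι} {f : ι → X ≃ᵢ X} {g : X ≃ᵢ X} :
    Tendsto f F (𝓝 g) ↔ ∀ x, Tendsto (fun i => f i x) F (𝓝 (g x)) := by
  constructor
  · intro h x
    exact ((continuous_iso_apply x).tendsto g).comp h
  · intro h
    rw [nhds_induced, tendsto_comap_iff,
      ContinuousMap.tendsto_iff_forall_isCompact_tendstoUniformlyOn]
    intro K hK
    rw [Metric.tendstoUniformlyOn_iff]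
    intro ε hε
    obtain ⟨t, -, ht, hcov⟩ := hK.finite_cover_balls (e := ε / 3) (by positivity)
    have hev : ∀ᶠ i in F, ∀ y ∈ t, dist (f i y) (g y) < ε / 3 :=
      (eventually_all_finite ht).2 fun y _ => Metric.tendsto_nhds.1 (h y) _ (by positivity)
    filter_upwards [hev] with i hi x hx
    obtain ⟨y, hy, hxy⟩ := mem_iUnion₂.1 (hcov hx)
    rw [Metric.mem_ball] at hxy
    change dist (g x) (f i x) < ε
    have h1 : dist (g x) (g y) = dist x y := g.dist_eq x y
    have h2 : dist (f i x) (f i y) = dist x y := (f i).dist_eq x y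
    have h3 := hi y hy
    have h4 := dist_triangle (g x) (g y) (f i x)
    have h5 := dist_triangle (g y) (f i y) (f i x)
    rw [dist_comm (g y) (f i y), dist_comm (f i y) (f i x)] at h5
    linarith

theorem tendsto_iso_apply {ι : Type*} {F : Filter ι} {f : ι → X ≃ᵢ X} {g : X ≃ᵢ X} {u : ι → X}
    {x : X} (hf : ∀ x, Tendsto (fun i => f i x) F (𝓝 (g x))) (hu : Tendsto u F (𝓝 x)) :
    Tendsto (fun i => f i (u i)) F (𝓝 (g x)) := by
  rw [tendsto_iff_dist_tendsto_zero] at hu ⊢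
  have h1 := tendsto_iff_dist_tendsto_zero.1 (hf x)
  have h2 := hu.add h1
  rw [add_zero] at h2
  refine squeeze_zero (fun _ => dist_nonneg) (fun i => ?_) h2
  rw [← (f i).dist_eq (u i) x]
  exact dist_triangle _ _ _

theorem continuous_iso_apply_prod : Continuous fun p : (X ≃ᵢ X) × X => p.1 p.2 := by
  refine continuous_iff_continuousAt.2 fun p => ?_
  exact tendsto_iso_apply (tendsto_iso_iff.1 (continuous_fst.tendsto p)) (continuous_snd.tendsto p)

instance : IsTopologicalGroup (X ≃ᵢ X) where
  continuous_mul := by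
    refine continuous_iff_continuousAt.2 fun p => tendsto_iso_iff.2 fun x => ?_
    exact tendsto_iso_apply (f := fun q : (X ≃ᵢ X) × (X ≃ᵢ X) => q.1) (g := p.1)
      (u := fun q => q.2 x) (tendsto_iso_iff.1 (continuous_fst.tendsto p))
      (tendsto_iso_iff.1 (continuous_snd.tendsto p) x)
  continuous_inv := by
    refine continuous_iff_continuousAt.2 fun g => tendsto_iso_iff.2 fun x => ?_
    -- Applying `f` turns the distance of `f⁻¹ x` and `g⁻¹ x` into that of `x = g (g⁻¹ x)` and `f
    -- (g⁻¹ x)`.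
    have h := tendsto_iff_dist_tendsto_zero.1 ((continuous_iso_apply (g⁻¹ x)).tendsto g)
    rw [tendsto_iff_dist_tendsto_zero]
    refine h.congr fun f => ?_
    have h1 : g (g⁻¹ x) = x := g.apply_symm_apply x
    have h2 : f (f⁻¹ x) = x := f.apply_symm_apply x
    rw [← f.dist_eq (f⁻¹ x), h1, h2, dist_comm]

/-- Properness gives pointwise limits along an ultrafilter, both of the isometries and of their
inverses. The second limit is a right inverse of the first, which is therefore onto. -/
theorem isCompact_iso [ProperSpace X] (x : X) (C : ℝ) :
    IsCompact {g : X ≃ᵢ X | dist (g x) x ≤ C} := by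
  rw [isCompact_iff_ultrafilter_le_nhds]
  intro U hU
  have hU' : ∀ᶠ g in (U : Filter (X ≃ᵢ X)), dist (g x) x ≤ C := le_principal_iff.1 hU
  have h1 : ∀ y, ∃ z, Tendsto (fun g : X ≃ᵢ X => g y) U (𝓝 z) := fun y => by
    refine exists_tendsto_of_dist_le U (x := x) (C := dist y x + C) ?_
    filter_upwards [hU'] with g hg
    have := dist_triangle (g y) (g x) x
    rw [g.dist_eq] at this
    linarith
  have h2 : ∀ y, ∃ z, Tendsto (fun g : X ≃ᵢ X => g⁻¹ y) U (𝓝 z) := fun y => by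
    refine exists_tendsto_of_dist_le U (x := x) (C := dist y x + C) ?_
    filter_upwards [hU'] with g hg
    have e : g (g⁻¹ y) = y := g.apply_symm_apply y
    rw [← g.dist_eq, e]
    have := dist_triangle y x (g x)
    rw [dist_comm x] at this
    linarith
  choose f hf using h1
  choose k hk using h2
  have hfi : Isometry f := Isometry.of_dist_eq fun y z =>
    tendsto_nhds_unique ((hf y).dist (hf z)) (by simp [IsometryEquiv.dist_eq])
  have hfk : ∀ y, f (k y) = y := by
    intro y
    have e1 := (hf (k y)).dist (tendsto_const_nhds (x := y))
    have e2 := (hk y).dist (tendsto_const_nhds (x := k y))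
    rw [dist_self] at e2
    have e3 : (fun g : X ≃ᵢ X => dist (g (k y)) y) = fun g : X ≃ᵢ X => dist (g⁻¹ y) (k y) := by
      funext g
      have e : g (g⁻¹ y) = y := g.apply_symm_apply y
      rw [← g.dist_eq (g⁻¹ y), e, dist_comm]
    rw [e3] at e1
    exact dist_eq_zero.1 (tendsto_nhds_unique e1 e2)
  let g₀ : X ≃ᵢ X := IsometryEquiv.mk' f k hfk hfi
  refine ⟨g₀, ?_, ?_⟩
  · exact le_of_tendsto ((hf x).dist tendsto_const_nhds) hU'
  · have : Tendsto id (U : Filter (X ≃ᵢ X)) (𝓝 g₀) := tendsto_iso_iff.2 hf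
    exact this

theorem isCompact_subgroup [ProperSpace X] {G : Subgroup (X ≃ᵢ X)}
    (hG : IsClosed (G : Set (X ≃ᵢ X))) (x : X) (C : ℝ) :
    IsCompact {g : G | dist ((g : X ≃ᵢ X) x) x ≤ C} :=
  hG.isClosedEmbedding_subtypeVal.isCompact_preimage (isCompact_iso x C)

/-- σ-compactness is what the open mapping theorem for orbit maps requires. -/
theorem sigmaCompactSpace_subgroup [ProperSpace X] [Nonempty X] {G : Subgroup (X ≃ᵢ X)}
    (hG : IsClosed (G : Set (X ≃ᵢ X))) : SigmaCompactSpace G := by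
  obtain ⟨x⟩ := ‹Nonempty X›
  refine ⟨⟨fun n : ℕ => {g : G | dist ((g : X ≃ᵢ X) x) x ≤ n},
    fun n => isCompact_subgroup hG x n, ?_⟩⟩
  refine eq_univ_of_forall fun g => mem_iUnion.2 ?_
  exact exists_nat_ge (dist ((g : X ≃ᵢ X) x) x)

theorem IsCAT0.continuous_smul_boundary [ProperSpace X] (hX : IsCAT0 X) :
    Continuous fun p : (X ≃ᵢ X) × Boundary X => p.1 • p.2 := by
  refine continuous_iff_continuousAt.2 fun p => ?_
  -- This ray only supplies a base point of `X`.
  obtain ⟨c⟩ := p.2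
  set x := c 0
  refine (hX.tendsto_boundary_iff x).2 fun t => ?_
  refine hX.tendsto_asymptotic_ray (c := fun q : (X ≃ᵢ X) × Boundary X => (hX.ray x q.2).map q.1)
    (d := (hX.ray x p.2).map p.1) ?_ ?_ ?_ ?_ t
  · intro s
    exact tendsto_iso_apply (tendsto_iso_iff.1 (continuous_fst.tendsto p))
      (((hX.continuous_ray x s).comp continuous_snd).tendsto p)
  · intro q
    rw [← endpoint_eq_iff, ← smul_endpoint, hX.ray_endpoint, hX.ray_endpoint]
  · rw [← endpoint_eq_iff, ← smul_endpoint, hX.ray_endpoint, hX.ray_endpoint]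
  · simp only [hX.ray_zero]
    exact tendsto_const_nhds

end Iso

/-! ### The limit set -/

section LimitSet

variable {X : Type*} [MetricSpace X] {G : Subgroup (X ≃ᵢ X)}

/-- An ideal point never belongs to a set of points of `X`, so removing it changes nothing. -/
theorem accPt_ideal_iff {ξ : Boundary X} {S : Set (Bordification X)}
    (hS : ∀ z ∈ S, ∃ x, z = Bordification.point x) :
    AccPt (Bordification.ideal ξ) (𝓟 S) ↔ Bordification.ideal ξ ∈ closure S := by
  have : S \ {Bordification.ideal ξ} = S := by
    refine sdiff_singleton_eq_self fun h => ?_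
    obtain ⟨x, hx⟩ := hS _ h
    cases hx
  rw [accPt_principal_iff_clusterPt, this, mem_closure_iff_clusterPt]

/-- A ray whose endpoint is approached by points of an orbit on the ray ends in the limit set. -/
theorem IsCAT0.endpoint_mem_limitSet [ProperSpace X] (hX : IsCAT0 X) (c : GeodesicRay X) (x : X)
    (h : ∀ n : ℕ, ∃ s : ℝ≥0, (n : ℝ≥0) ≤ s ∧ ∃ g ∈ G, g x = c s) : c.endpoint ∈ limitSet G := by
  refine ⟨x, (accPt_ideal_iff ?_).2 ?_⟩
  · rintro _ ⟨g, -, rfl⟩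
    exact ⟨_, rfl⟩
  choose s hs g hg hgs using h
  have hs' : Tendsto s atTop atTop := tendsto_atTop_mono hs tendsto_natCast_atTop_atTop
  refine mem_closure_of_tendsto (f := fun n => Bordification.point (c (s n))) (b := atTop) ?_
    (Eventually.of_forall fun n => ⟨g n, hg n, by rw [hgs]⟩)
  refine TopologicalSpace.tendsto_nhds_generateFrom_iff.2 ?_
  rintro U (⟨V, hV, rfl⟩ | ⟨d, r, ε, hr, hε, rfl⟩) hU
  · obtain ⟨y, -, hy⟩ := hU
    cases hy
  rw [hX.ideal_mem_coneNhd] at hU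
  -- The asymptotic ray from the origin of the neighbourhood. Segments from this origin to far
  -- points of `c` pass close to `c' r`.
  set c' := hX.ray (d 0) c.endpoint with hc'
  have hc'0 : c' 0 = d 0 := hX.ray_zero _ _
  have hasymp : c ≈ c' := endpoint_eq_iff.1 (hX.ray_endpoint _ _).symm
  set D := dist (c 0) (c' 0)
  set ℓ : ℕ → ℝ := fun n => dist (c' 0) (c (s n)) with hℓdef
  have hℓ : Tendsto ℓ atTop atTop := by
    refine tendsto_atTop_mono (f := fun n : ℕ => (s n : ℝ) - D) (fun n => ?_)
      (tendsto_atTop_add_const_right _ _ (NNReal.tendsto_coe_atTop.2 hs'))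
    have h1 := c.dist_eq 0 (s n)
    rw [NNReal.coe_zero, zero_sub, abs_neg, abs_of_nonneg (s n).coe_nonneg] at h1
    have := dist_triangle (c 0) (c' 0) (c (s n))
    simp only [hℓdef, D]
    linarith
  have hsmall : Tendsto (fun n => 2 * r * D / ℓ n) atTop (𝓝 0) :=
    tendsto_const_nhds.div_atTop hℓ
  filter_upwards [hℓ.eventually_gt_atTop r, hℓ.eventually_gt_atTop 0,
    hsmall.eventually_lt_const (sub_pos.2 hU)] with n hn1 hn0 hn2
  obtain ⟨p, hp⟩ := hX.exists_between (c' 0) (c (s n)) (t := r / ℓ n)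
    ⟨by positivity, (div_le_one hn0).2 hn1.le⟩
  have hp1 : dist (c' 0) p = r := by
    rw [hp.1]; change r / ℓ n * ℓ n = r; field_simp
  have hp2 : dist p (c (s n)) = dist (c' 0) (c (s n)) - r := by
    rw [hp.2]; change (1 - r / ℓ n) * ℓ n = ℓ n - r; field_simp
  refine Or.inl ⟨c (s n), rfl, by rw [← hc'0]; exact hn1, p, by rw [← hc'0]; exact hp1,
    by rw [← hc'0]; exact hp2, ?_⟩
  have := hX.dist_segment_ray_le (hX.dist_ray_le hasymp (s n)) hn1.le hn0 hp1 hp2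
  have h3 : dist p (c' r) < ε - dist (c' r) (d r) := this.trans_lt hn2
  linarith [dist_triangle p (c' r) (d r)]

/-- If `G` acts transitively on its limit set, then the limit set is closed. -/
theorem isClosed_limitSet (htrans : ∀ a b : limitSet G, ∃ g : G, g • a = b) :
    IsClosed (limitSet G : Set (Boundary X)) := by
  rcases (limitSet G : Set (Boundary X)).eq_empty_or_nonempty with he | ⟨ξ, hξ⟩
  · rw [he]; exact isClosed_empty
  obtain ⟨x, hx⟩ := id hξ
  set S : Set (Bordification X) := {z | ∃ g ∈ G, z = Bordification.point (g x)}
  have hS : ∀ z ∈ S, ∃ x, z = Bordification.point x := by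
    rintro _ ⟨g, -, rfl⟩
    exact ⟨_, rfl⟩
  -- A single orbit suffices: its accumulation points are permuted by `G`, and transitivity moves
  -- one of them to every limit point.
  have : (limitSet G : Set (Boundary X)) = Bordification.ideal ⁻¹' closure S := by
    refine Subset.antisymm (fun η hη => ?_) fun η hη => ⟨x, (accPt_ideal_iff hS).2 hη⟩
    obtain ⟨g, hg⟩ := htrans ⟨ξ, hξ⟩ ⟨η, hη⟩
    have hg' : (g : X ≃ᵢ X) • ξ = η := congrArg Subtype.val hg
    rw [← hg']
    change Bordification.map (g : X ≃ᵢ X) (Bordification.ideal ξ) ∈ closure S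
    have h1 := image_closure_subset_closure_image (Bordification.continuous_map (g : X ≃ᵢ X))
      (mem_image_of_mem _ ((accPt_ideal_iff hS).1 hx))
    refine closure_mono ?_ h1
    rintro _ ⟨_, ⟨k, hk, rfl⟩, rfl⟩
    exact ⟨g * k, G.mul_mem g.2 hk, rfl⟩
  rw [this]
  exact isClosed_closure.preimage continuous_induced_dom

theorem axis_translate {g : X ≃ᵢ X} {γ : GeodesicLine X} {τ : ℝ} (h : ∀ t, g (γ t) = γ (t + τ))
    (n : ℕ) (t : ℝ) : (g ^ n) (γ t) = γ (t + n * τ) := by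
  induction n with
  | zero => simp
  | succ n ih =>
    rw [pow_succ', IsometryEquiv.mul_apply, ih, h]
    push_cast
    ring_nf

theorem IsCAT0.posEnd_mem_limitSet [ProperSpace X] (hX : IsCAT0 X) {g : X ≃ᵢ X} (hg : g ∈ G)
    {γ : GeodesicLine X} {τ : ℝ} (hτ : 0 < τ) (h : ∀ t, g (γ t) = γ (t + τ)) :
    γ.posEnd ∈ limitSet G := by
  refine hX.endpoint_mem_limitSet _ (γ 0) fun n => ?_
  obtain ⟨m, hm⟩ := exists_nat_ge (n / τ)
  refine ⟨⟨m * τ, by positivity⟩, ?_, g ^ m, G.pow_mem hg m, ?_⟩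
  · rw [div_le_iff₀ hτ] at hm
    exact hm
  · rw [axis_translate h, zero_add]
    rfl

/-- The line with the opposite orientation. -/
def GeodesicLine.reverse (γ : GeodesicLine X) : GeodesicLine X :=
  ⟨fun t => γ (-t), γ.isometry.comp (IsometryEquiv.neg ℝ).isometry⟩

theorem GeodesicLine.reverse_apply (γ : GeodesicLine X) (t : ℝ) : γ.reverse t = γ (-t) := rfl

theorem GeodesicLine.reverse_posEnd (γ : GeodesicLine X) : γ.reverse.posEnd = γ.negEnd := rfl

theorem GeodesicLine.reverse_reverse (γ : GeodesicLine X) : γ.reverse.reverse = γ := by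
  cases γ
  simp [GeodesicLine.reverse]

theorem GeodesicLine.reverse_negEnd (γ : GeodesicLine X) : γ.reverse.negEnd = γ.posEnd := by
  rw [← γ.reverse.reverse_posEnd, γ.reverse_reverse]

theorem GeodesicLine.range_reverse (γ : GeodesicLine X) : range γ.reverse = range γ := by
  ext x
  exact ⟨fun ⟨t, ht⟩ => ⟨-t, ht⟩, fun ⟨t, ht⟩ => ⟨-t, by rw [γ.reverse_apply, neg_neg, ht]⟩⟩

theorem IsCAT0.negEnd_mem_limitSet [ProperSpace X] (hX : IsCAT0 X) {g : X ≃ᵢ X} (hg : g ∈ G)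
    {γ : GeodesicLine X} {τ : ℝ} (hτ : 0 < τ) (h : ∀ t, g (γ t) = γ (t + τ)) :
    γ.negEnd ∈ limitSet G := by
  rw [← γ.reverse_posEnd]
  refine hX.posEnd_mem_limitSet (G.inv_mem hg) hτ fun t => ?_
  rw [γ.reverse_apply, γ.reverse_apply]
  have := h (-(t + τ))
  rw [neg_add, neg_add_cancel_right] at this
  rw [neg_add, ← this]
  exact g.symm_apply_apply _

end LimitSet

/-! ### Endpoints of lines -/

section Lines

variable {X : Type*} [MetricSpace X]

theorem posEnd_eq_iff {γ γ' : GeodesicLine X} :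
    γ.posEnd = γ'.posEnd ↔ ∃ C, ∀ t, 0 ≤ t → dist (γ t) (γ' t) ≤ C := by
  rw [GeodesicLine.posEnd, GeodesicLine.posEnd, endpoint_eq_iff]
  exact ⟨fun ⟨C, h⟩ => ⟨C, fun t ht => h ⟨t, ht⟩⟩, fun ⟨C, h⟩ => ⟨C, fun t => h t t.2⟩⟩

theorem GeodesicLine.negEnd_ne_posEnd (γ : GeodesicLine X) : γ.negEnd ≠ γ.posEnd := by
  rw [← γ.reverse_posEnd, Ne, posEnd_eq_iff]
  rintro ⟨C, h⟩
  have hC : 0 ≤ |C| + 1 := by positivity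
  have := h (|C| + 1) hC
  rw [γ.reverse_apply, γ.dist_eq, abs_sub_comm, sub_neg_eq_add, abs_of_nonneg (by linarith)] at this
  linarith [le_abs_self C]

/-- Close points have nearly equal parameters, so `α t` and `β t` are uniformly close for
arbitrarily large `t`; convexity extends the bound to all smaller nonnegative parameters. -/
theorem IsCAT0.posEnd_eq_of_close (hX : IsCAT0 X) {α β : GeodesicLine X} {C : ℝ}
    (h : ∀ N : ℝ, ∃ t, N ≤ t ∧ ∃ s, 0 ≤ s ∧ dist (α t) (β s) ≤ C) : α.posEnd = β.posEnd := by
  rw [posEnd_eq_iff]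
  refine ⟨2 * dist (α 0) (β 0) + 2 * C, fun u hu => ?_⟩
  obtain ⟨t, ht, s, hs, hts⟩ := h (u + 1)
  have ht0 : 0 < t := by linarith
  have hC : 0 ≤ C := dist_nonneg.trans hts
  set d := dist (α 0) (β 0)
  have hd : 0 ≤ d := dist_nonneg
  have e1 : |t - s| ≤ d + C := by
    have a1 := α.dist_eq 0 t
    have a2 := β.dist_eq 0 s
    rw [zero_sub, abs_neg, abs_of_nonneg ht0.le] at a1
    rw [zero_sub, abs_neg, abs_of_nonneg hs] at a2
    have a3 := dist_triangle4 (α 0) (β 0) (β s) (α t)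
    have a4 := dist_triangle4 (β 0) (α 0) (α t) (β s)
    rw [dist_comm (β s)] at a3
    rw [dist_comm (β 0) (α 0)] at a4
    rw [abs_le]
    constructor <;> linarith
  have e2 : dist (α t) (β t) ≤ d + 2 * C := by
    have := dist_triangle (α t) (β s) (β t)
    rw [β.dist_eq, abs_sub_comm] at this
    linarith
  have hut : u / t ∈ Icc (0 : ℝ) 1 := ⟨by positivity, (div_le_one ht0).2 (by linarith)⟩
  have b1 := α.between 0 t hut
  have b2 := β.between 0 t hut
  have e3 : (1 - u / t) * 0 + u / t * t = u := by field_simp; ring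
  rw [e3] at b1 b2
  have := hX.dist_le_of_between hut b1 b2
  have h1 : (1 - u / t) * d ≤ d := mul_le_of_le_one_left hd (by linarith [hut.1])
  have h2 : u / t * dist (α t) (β t) ≤ dist (α t) (β t) :=
    mul_le_of_le_one_left dist_nonneg hut.2
  linarith

/-- A line moves away from every line that does not share the endpoint in question. -/
theorem IsCAT0.exists_forall_lt_dist (hX : IsCAT0 X) {α β : GeodesicLine X}
    (h1 : α.posEnd ≠ β.posEnd) (h2 : α.posEnd ≠ β.negEnd) (C : ℝ) :
    ∃ N : ℝ, ∀ t, N ≤ t → ∀ s, C < dist (α t) (β s) := by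
  obtain ⟨N₁, hN₁⟩ : ∃ N : ℝ, ∀ t, N ≤ t → ∀ s, 0 ≤ s → C < dist (α t) (β s) := by
    by_contra! hcon
    exact h1 (hX.posEnd_eq_of_close hcon)
  obtain ⟨N₂, hN₂⟩ : ∃ N : ℝ, ∀ t, N ≤ t → ∀ s, 0 ≤ s → C < dist (α t) (β.reverse s) := by
    by_contra! hcon
    exact h2 ((hX.posEnd_eq_of_close hcon).trans β.reverse_posEnd)
  refine ⟨max N₁ N₂, fun t ht s => ?_⟩
  rcases le_total 0 s with hs | hs
  · exact hN₁ t (le_trans (le_max_left _ _) ht) s hs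
  · have := hN₂ t (le_trans (le_max_right _ _) ht) (-s) (by linarith)
    rwa [β.reverse_apply, neg_neg] at this

/-- The image of a line under an isometry. -/
def GeodesicLine.map (g : X ≃ᵢ X) (γ : GeodesicLine X) : GeodesicLine X :=
  ⟨fun t => g (γ t), g.isometry.comp γ.isometry⟩

theorem GeodesicLine.range_map (g : X ≃ᵢ X) (γ : GeodesicLine X) :
    range (γ.map g) = g '' range γ := range_comp g γ

theorem GeodesicLine.infDist_map (g : X ≃ᵢ X) (γ : GeodesicLine X) (x : X) :
    Metric.infDist (g x) (range (γ.map g)) = Metric.infDist x (range γ) := by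
  rw [γ.range_map, Metric.infDist_image g.isometry]

theorem IsContracting.map {B : ℝ} {γ : GeodesicLine X} (h : IsContracting B γ) (g : X ≃ᵢ X) :
    IsContracting B (γ.map g) := by
  have key : ∀ x r, ∀ p ∈ projectionImage (range (γ.map g)) (Metric.closedBall x r),
      ∃ q ∈ projectionImage (range γ) (Metric.closedBall (g.symm x) r), g q = p := by
    rintro x r p ⟨⟨t, rfl⟩, y, hy, hmin⟩
    refine ⟨γ t, ⟨⟨t, rfl⟩, g.symm y, ?_, ?_⟩, rfl⟩
    · rwa [Metric.mem_closedBall, g.symm.dist_eq]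
    · rintro _ ⟨s, rfl⟩
      have := hmin (g (γ s)) ⟨s, rfl⟩
      rw [← g.dist_eq, ← g.dist_eq (g.symm y), g.apply_symm_apply]
      exact this
  intro x r hdisj p hp q hq
  obtain ⟨p', hp', rfl⟩ := key x r p hp
  obtain ⟨q', hq', rfl⟩ := key x r q hq
  rw [g.dist_eq]
  refine h (g.symm x) r ?_ p' hp' q' hq'
  rw [Set.disjoint_left] at hdisj ⊢
  rintro _ hz ⟨t, rfl⟩
  refine hdisj (a := g (γ t)) ?_ ⟨t, rfl⟩
  rw [Metric.mem_closedBall] at hz ⊢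
  rwa [← g.dist_eq, g.apply_symm_apply] at hz

end Lines

/-! ### Contracting lines -/

section Contracting

variable {X : Type*} [MetricSpace X]

/-- The ball about `x` through `y` misses `γ`, and its projection contains the feet of both points.
-/
theorem IsContracting.abs_proj_sub_le {B : ℝ} {γ : GeodesicLine X} (hγ : IsContracting B γ)
    {x y : X} {p q : ℝ} (hp : Metric.infDist x (range γ) = dist x (γ p))
    (hq : Metric.infDist y (range γ) = dist y (γ q))
    (hxy : dist x y < Metric.infDist x (range γ)) : |p - q| ≤ B := by
  rw [← γ.dist_eq]
  refine hγ x (dist x y) ?_ _ ⟨⟨p, rfl⟩, x, ?_, ?_⟩ _ ⟨⟨q, rfl⟩, y, ?_, ?_⟩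
  · rw [Set.disjoint_left]
    intro z hz hz'
    have := Metric.infDist_le_dist_of_mem (x := x) hz'
    rw [Metric.mem_closedBall, dist_comm] at hz
    linarith
  · exact Metric.mem_closedBall_self dist_nonneg
  · intro z hz
    rw [← hp]
    exact Metric.infDist_le_dist_of_mem hz
  · rw [Metric.mem_closedBall, dist_comm]
  · intro z hz
    rw [← hq]
    exact Metric.infDist_le_dist_of_mem hz

theorem exists_forall_infDist_le {γ γ' : GeodesicLine X} (h1 : γ.posEnd = γ'.posEnd)
    (h2 : γ.negEnd = γ'.negEnd) : ∃ C, ∀ t, Metric.infDist (γ t) (range γ') ≤ C := by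
  obtain ⟨M₁, hM₁⟩ := posEnd_eq_iff.1 h1
  obtain ⟨M₂, hM₂⟩ := posEnd_eq_iff.1 (γ.reverse_posEnd.trans (h2.trans γ'.reverse_posEnd.symm))
  refine ⟨max M₁ M₂, fun t => (γ'.infDist_le _ t).trans ?_⟩
  rcases le_total 0 t with ht | ht
  · exact (hM₁ t ht).trans (le_max_left _ _)
  · have := hM₂ (-t) (by linarith)
    rw [γ.reverse_apply, γ'.reverse_apply, neg_neg] at this
    exact this.trans (le_max_right _ _)

variable [ProperSpace X] {B : ℝ} {γ : GeodesicLine X}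

/-- Outside the `2 * B`-neighbourhood of `γ`, each step of length `2 * B` moves the foot by at most
`B`: the projection has at most half the speed of `σ`, up to one extra step for the remainder. -/
theorem IsContracting.abs_sub_le_mul (hγ : IsContracting B γ) (hB : 0 < B) (σ : GeodesicLine X)
    {b : ℝ} (n : ℕ) : ∀ {a : ℝ}, a ≤ b → (∀ s ∈ Icc a b, 2 * B < Metric.infDist (σ s) (range γ)) →
    b - a ≤ (n + 1) * (2 * B) → ∀ {p q : ℝ}, Metric.infDist (σ a) (range γ) = dist (σ a) (γ p) →
    Metric.infDist (σ b) (range γ) = dist (σ b) (γ q) → |p - q| ≤ (n + 1) * B := by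
  induction n with
  | zero =>
    intro a hab hfar hlen p q hp hq
    rw [Nat.cast_zero, zero_add, one_mul] at hlen ⊢
    refine hγ.abs_proj_sub_le hp hq (lt_of_le_of_lt ?_ (hfar a ⟨le_rfl, hab⟩))
    rwa [σ.dist_eq, abs_sub_comm, abs_of_nonneg (by linarith)]
  | succ n ih =>
    intro a hab hfar hlen p q hp hq
    push_cast at hlen ⊢
    rcases le_total b (a + 2 * B) with hle | hle
    · have : |p - q| ≤ B := by
        refine hγ.abs_proj_sub_le hp hq (lt_of_le_of_lt ?_ (hfar a ⟨le_rfl, hab⟩))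
        rw [σ.dist_eq, abs_sub_comm, abs_of_nonneg (by linarith)]
        linarith
      refine this.trans ?_
      nlinarith [(Nat.cast_nonneg n : (0 : ℝ) ≤ n)]
    · obtain ⟨r, hr⟩ := γ.exists_infDist (σ (a + 2 * B))
      have h1 : |p - r| ≤ B := by
        refine hγ.abs_proj_sub_le hp hr (lt_of_le_of_lt ?_ (hfar a ⟨le_rfl, hab⟩))
        rw [σ.dist_eq, abs_sub_comm, abs_of_nonneg (by linarith)]
        linarith
      have h2 := ih hle (fun s hs => hfar s ⟨by linarith [hs.1], hs.2⟩) (by linarith) hr hq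
      linarith [abs_sub_le p r q]

/-- A geodesic that stays far from a contracting line projects to a bounded set. -/
theorem IsContracting.abs_sub_le_of_far (hγ : IsContracting B γ) (hB : 0 < B) (σ : GeodesicLine X)
    {a b : ℝ} (hab : a ≤ b) (hfar : ∀ s ∈ Icc a b, 2 * B < Metric.infDist (σ s) (range γ))
    {p q : ℝ} (hp : Metric.infDist (σ a) (range γ) = dist (σ a) (γ p))
    (hq : Metric.infDist (σ b) (range γ) = dist (σ b) (γ q)) : |p - q| ≤ 8 * B := by
  set dx := Metric.infDist (σ a) (range γ) with hdx
  set dy := Metric.infDist (σ b) (range γ) with hdy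
  have hdx2 : 2 * B < dx := hfar a ⟨le_rfl, hab⟩
  have hdy2 : 2 * B < dy := hfar b ⟨hab, le_rfl⟩
  have hL : dist (σ a) (σ b) = b - a := by
    rw [σ.dist_eq, abs_sub_comm, abs_of_nonneg (by linarith)]
  rcases lt_or_ge (b - a) dx with h1 | h1
  · linarith [hγ.abs_proj_sub_le hp hq (by rwa [hL])]
  rcases lt_or_ge (b - a) dy with h2 | h2
  · have := hγ.abs_proj_sub_le hq hp (by rwa [dist_comm, hL])
    rw [abs_sub_comm] at this
    linarith
  rcases lt_or_ge (b - a) (dx + dy) with h3 | h3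
  -- `σ m` has distance less than `dx` from `σ a` and less than `dy` from `σ b`, so two balls cover
  -- the segment.
  · set m := a + (b - a - dy + dx) / 2 with hm
    obtain ⟨r, hr⟩ := γ.exists_infDist (σ m)
    have e1 : |p - r| ≤ B := by
      refine hγ.abs_proj_sub_le hp hr ?_
      rw [σ.dist_eq, abs_sub_comm, abs_of_nonneg (by linarith)]
      linarith
    have e2 : |q - r| ≤ B := by
      refine hγ.abs_proj_sub_le hq hr ?_
      rw [σ.dist_eq, abs_of_nonneg (by linarith)]
      linarith
    rw [abs_sub_comm] at e2
    linarith [abs_sub_le p r q]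
  -- One ball at each end covers lengths `dx - B` and `dy - B` at a cost of `B` each. The middle has
  -- length at most `|p - q| + 2 * B` and is projected at half speed, so `|p - q| ≤ 2 * B + |p - q|
  -- / 2 + 2 * B`.
  · set a' := a + (dx - B) with ha'
    set b' := b - (dy - B) with hb'
    obtain ⟨r, hr⟩ := γ.exists_infDist (σ a')
    obtain ⟨u, hu⟩ := γ.exists_infDist (σ b')
    have e1 : |p - r| ≤ B := by
      refine hγ.abs_proj_sub_le hp hr ?_
      rw [σ.dist_eq, abs_sub_comm, abs_of_nonneg (by linarith)]
      linarith
    have e2 : |q - u| ≤ B := by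
      refine hγ.abs_proj_sub_le hq hu ?_
      rw [σ.dist_eq, abs_of_nonneg (by linarith)]
      linarith
    have hlen : b - a ≤ dx + |p - q| + dy := by
      have := dist_triangle4 (σ a) (γ p) (γ q) (σ b)
      rw [hL, γ.dist_eq, dist_comm (γ q), ← hp, ← hq] at this
      exact this
    have hpos : 0 ≤ (b' - a') / (2 * B) := div_nonneg (by linarith) (by linarith)
    have e3 := hγ.abs_sub_le_mul hB σ ⌊(b' - a') / (2 * B)⌋₊ (a := a') (b := b') (by linarith)
      (fun s hs => hfar s ⟨by linarith [hs.1], by linarith [hs.2]⟩)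
      (by
        have := (Nat.lt_floor_add_one ((b' - a') / (2 * B))).le
        rwa [div_le_iff₀ (by linarith)] at this) hr hu
    have e4 : (⌊(b' - a') / (2 * B)⌋₊ : ℝ) * B ≤ (b' - a') / 2 := by
      have := mul_le_mul_of_nonneg_right (Nat.floor_le hpos) hB.le
      refine this.trans_eq ?_
      field_simp
    have e5 := abs_sub_le p r q
    have e6 := abs_sub_le r u q
    rw [abs_sub_comm q u] at e2
    linarith

/-- A geodesic whose endpoints project far apart passes close to the projections. -/
theorem IsContracting.exists_dist_le (hγ : IsContracting B γ) (hB : 0 < B) (σ : GeodesicLine X)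
    {a b : ℝ} (hab : a ≤ b)
    {p q : ℝ} (hp : Metric.infDist (σ a) (range γ) = dist (σ a) (γ p))
    (hq : Metric.infDist (σ b) (range γ) = dist (σ b) (γ q)) (hpq : 8 * B < |p - q|) :
    ∃ s, dist (σ s) (γ p) ≤ 11 * B := by
  set A : Set ℝ := {s | s ∈ Icc a b ∧ Metric.infDist (σ s) (range γ) ≤ 2 * B} with hA
  have hcont : Continuous fun s => Metric.infDist (σ s) (range γ) :=
    (Metric.continuous_infDist_pt _).comp σ.isometry.continuous
  have hcomp : IsCompact A :=
    isCompact_Icc.inter_right (isClosed_le hcont continuous_const)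
  have hne : A.Nonempty := by
    by_contra hemp
    refine absurd (hγ.abs_sub_le_of_far hB σ hab (fun s hs => ?_) hp hq) (not_le.2 hpq)
    by_contra! hle
    exact hemp ⟨s, hs, hle⟩
  obtain ⟨s₀, ⟨hs₀, hs₀'⟩, hmin⟩ := hcomp.exists_isLeast hne
  rcases hs₀.1.eq_or_lt with rfl | hlt
  · exact ⟨a, by rw [← hp]; linarith⟩
  -- Just before the first entrance `s₀` into the `2 * B`-neighbourhood the geodesic is still far,
  -- so its foot is within `8 * B` of `γ p`, while stepping back by at most `B` keeps it within `3 *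
  -- B` of `γ`.
  set s₁ := max a (s₀ - B) with hs₁
  have h1 : a ≤ s₁ := le_max_left _ _
  have h2 : s₁ < s₀ := max_lt hlt (by linarith)
  have h3 : s₀ - B ≤ s₁ := le_max_right _ _
  obtain ⟨r, hr⟩ := γ.exists_infDist (σ s₁)
  have e1 := hγ.abs_sub_le_of_far hB σ h1 (fun s hs => by
    by_contra! hle
    have := hmin ⟨⟨hs.1, by linarith [hs.2, hs₀.2]⟩, hle⟩
    linarith [hs.2]) hp hr
  have e2 : Metric.infDist (σ s₁) (range γ) ≤ 3 * B := by
    have := Metric.infDist_le_infDist_add_dist (s := range γ) (x := σ s₁) (y := σ s₀)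
    rw [σ.dist_eq, abs_sub_comm, abs_of_nonneg (by linarith)] at this
    linarith
  refine ⟨s₁, ?_⟩
  have := dist_triangle (σ s₁) (γ r) (γ p)
  rw [γ.dist_eq, abs_sub_comm, ← hr] at this
  linarith

/-- Ideal triangles with a contracting side have a point close to all sides. -/
theorem IsContracting.exists_center (hX : IsCAT0 X) (hγ : IsContracting B γ) (hB : 0 < B)
    {σ ρ : GeodesicLine X} (hb : σ.posEnd = γ.posEnd) (ha : ρ.posEnd = γ.negEnd)
    (hc : σ.negEnd = ρ.negEnd) (hca : σ.negEnd ≠ γ.negEnd) (hcb : σ.negEnd ≠ γ.posEnd) :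
    ∃ p s t, dist (σ s) (γ p) ≤ 12 * B ∧ dist (ρ t) (γ p) ≤ 12 * B := by
  have hab := γ.negEnd_ne_posEnd
  obtain ⟨M₁, hM₁⟩ := posEnd_eq_iff.1 hb
  obtain ⟨M₂, hM₂⟩ := posEnd_eq_iff.1 (ha.trans γ.reverse_posEnd.symm)
  obtain ⟨M₃, hM₃⟩ := posEnd_eq_iff.1 (σ.reverse_posEnd.trans (hc.trans ρ.reverse_posEnd.symm))
  obtain ⟨N₁, hN₁⟩ := hX.exists_forall_lt_dist (α := σ.reverse) (β := γ)
    (by rwa [σ.reverse_posEnd]) (by rwa [σ.reverse_posEnd]) M₃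
  obtain ⟨N₂, hN₂⟩ := hX.exists_forall_lt_dist (α := γ) (β := ρ)
    (by rw [ha]; exact hab.symm) (by rw [← hc]; exact hcb.symm) (11 * B)
  obtain ⟨N₃, hN₃⟩ := hX.exists_forall_lt_dist (α := γ.reverse) (β := σ)
    (by rw [γ.reverse_posEnd, hb]; exact hab) (by rw [γ.reverse_posEnd]; exact hca.symm) (11 * B)
  -- At parameter `-S` the lines `σ` and `ρ` are closer to each other than to `γ`, so their feet
  -- nearly agree; at `S` their feet are near `γ S` and `γ (-S)`. The margin `9 * B` is `8 * B` for
  -- a short projection plus `B` for the gap between `p` and `p'`.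
  obtain ⟨S, hS0, hS1, hS2, hS3, hS4⟩ : ∃ S : ℝ, 0 ≤ S ∧ N₁ ≤ S ∧ N₂ + 2 * M₁ + 9 * B ≤ S ∧
      N₃ + 2 * M₂ + 9 * B ≤ S ∧ 2 * M₁ + 2 * M₂ + 18 * B ≤ S :=
    ⟨max 0 (max N₁ (max (N₂ + 2 * M₁ + 9 * B) (max (N₃ + 2 * M₂ + 9 * B)
      (2 * M₁ + 2 * M₂ + 18 * B)))), by simp, by simp, by simp, by simp, by simp⟩
  obtain ⟨p, hp⟩ := γ.exists_infDist (σ (-S))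
  obtain ⟨p', hp'⟩ := γ.exists_infDist (ρ (-S))
  obtain ⟨q, hq⟩ := γ.exists_infDist (σ S)
  obtain ⟨q', hq'⟩ := γ.exists_infDist (ρ S)
  have hpp' : |p - p'| ≤ B := by
    refine hγ.abs_proj_sub_le hp hp' (lt_of_le_of_lt (hM₃ S hS0) ?_)
    rw [hp]
    exact hN₁ S hS1 p
  have hqS : |q - S| ≤ 2 * M₁ := by
    have h1 := hM₁ S hS0
    have h2 := γ.infDist_le (σ S) S
    have h3 := dist_triangle (γ q) (σ S) (γ S)
    rw [γ.dist_eq, dist_comm (γ q), ← hq] at h3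
    linarith
  have hqS' : |q' + S| ≤ 2 * M₂ := by
    have h1 := hM₂ S hS0
    have h2 := γ.infDist_le (ρ S) (-S)
    have h3 := dist_triangle (γ q') (ρ S) (γ (-S))
    rw [γ.dist_eq, dist_comm (γ q'), ← hq', sub_neg_eq_add] at h3
    rw [γ.reverse_apply] at h1
    linarith
  rw [abs_le] at hqS hqS'
  have hSS : -S ≤ S := by linarith
  -- If `p` were near `q`, then `p'` would be far out towards the positive end of `γ` and `ρ` would
  -- pass close to `γ p'`, against the choice of `N₂`. The next case is symmetric. So both lines
  -- pass close to `γ p`.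
  rcases le_or_gt (|p - q|) (8 * B) with h1 | h1
  · exfalso
    have hpp := abs_le.1 hpp'
    have h1' := abs_le.1 h1
    have hlt : 8 * B < |p' - q'| := lt_of_lt_of_le (by linarith) (le_abs_self _)
    obtain ⟨t, ht⟩ := hγ.exists_dist_le hB ρ hSS hp' hq' hlt
    have := hN₂ p' (by linarith) t
    rw [dist_comm] at this
    linarith
  rcases le_or_gt (|p' - q'|) (8 * B) with h2 | h2
  · exfalso
    have hpp := abs_le.1 hpp'
    have h2' := abs_le.1 h2
    obtain ⟨t, ht⟩ := hγ.exists_dist_le hB σ hSS hp hq h1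
    have := hN₃ (-p) (by linarith) t
    rw [γ.reverse_apply, neg_neg, dist_comm] at this
    linarith
  · obtain ⟨s, hs⟩ := hγ.exists_dist_le hB σ hSS hp hq h1
    obtain ⟨t, ht⟩ := hγ.exists_dist_le hB ρ hSS hp' hq' h2
    refine ⟨p, s, t, by linarith, ?_⟩
    have := dist_triangle (ρ t) (γ p') (γ p)
    rw [γ.dist_eq, abs_sub_comm] at this
    linarith

/-- The distance to `γ'` along `γ` is convex and bounded, hence constant. -/
theorem IsCAT0.infDist_eq_of_parallel (hX : IsCAT0 X) {γ γ' : GeodesicLine X}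
    (h1 : γ.posEnd = γ'.posEnd) (h2 : γ.negEnd = γ'.negEnd) (s t : ℝ) :
    Metric.infDist (γ s) (range γ') = Metric.infDist (γ t) (range γ') := by
  obtain ⟨C, hC⟩ := exists_forall_infDist_le h1 h2
  exact eq_of_convexOn_of_le ((hX.geodesicallyConvex_infDist γ').convexOn_line γ) hC s t

/-- Lines parallel to a `B`-contracting line are at distance at most `B` from it. -/
theorem IsContracting.infDist_le_of_parallel (hX : IsCAT0 X) (hγ : IsContracting B γ) (hB : 0 < B)
    {γ' : GeodesicLine X} (h1 : γ'.posEnd = γ.posEnd) (h2 : γ'.negEnd = γ.negEnd) (t : ℝ) :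
    Metric.infDist (γ' t) (range γ) ≤ B := by
  set w := Metric.infDist (γ' t) (range γ) with hw
  have hconst : ∀ s, Metric.infDist (γ' s) (range γ) = w := fun s =>
    hX.infDist_eq_of_parallel h1 h2 s t
  by_contra! hlt
  -- With `B < L < w`, steps of length `L` along `γ'` move the foot by at most `B` each. After `n`
  -- steps `n * L ≤ 2 * w + n * B`, which fails for large `n`.
  set L := (B + w) / 2 with hL
  have hBL : B < L := by linarith
  choose p hp using fun n : ℕ => γ.exists_infDist (γ' (n * L))
  have hstep : ∀ n, |p 0 - p n| ≤ n * B := by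
    intro n
    induction n with
    | zero => simp
    | succ n ih =>
      have : |p n - p (n + 1)| ≤ B := by
        refine hγ.abs_proj_sub_le (hp n) (hp (n + 1)) ?_
        rw [hconst, γ'.dist_eq]
        have e : (n : ℝ) * L - ((n + 1 : ℕ) : ℝ) * L = -L := by push_cast; ring
        rw [e, abs_neg, abs_of_nonneg (by linarith)]
        linarith
      have h3 := abs_sub_le (p 0) (p n) (p (n + 1))
      push_cast
      linarith
  obtain ⟨n, hn⟩ := exists_nat_gt (2 * w / (L - B))
  rw [div_lt_iff₀ (sub_pos.2 hBL)] at hn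
  have h4 := dist_triangle4 (γ' ((0 : ℕ) * L)) (γ (p 0)) (γ (p n)) (γ' (n * L))
  rw [dist_comm (γ (p n)), ← hp, ← hp, hconst, hconst, γ.dist_eq, γ'.dist_eq, Nat.cast_zero,
    zero_mul, zero_sub, abs_neg, abs_of_nonneg (mul_nonneg n.cast_nonneg (by linarith))] at h4
  linarith [hstep n]

/-- Makes the supremum over all lines with given endpoints finite, and comparable to the distance to
one contracting line. -/
theorem IsContracting.infDist_le_add (hX : IsCAT0 X) (hγ : IsContracting B γ) (hB : 0 < B)
    {γ' : GeodesicLine X} (h1 : γ'.posEnd = γ.posEnd) (h2 : γ'.negEnd = γ.negEnd) (x : X) :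
    Metric.infDist x (range γ') ≤ Metric.infDist x (range γ) + B := by
  obtain ⟨s, hs⟩ := γ.exists_infDist x
  obtain ⟨u, hu⟩ := γ.exists_infDist (γ' 0)
  have h3 : Metric.infDist (γ s) (range γ') ≤ B := by
    rw [hX.infDist_eq_of_parallel h1.symm h2.symm s u]
    refine (γ'.infDist_le _ 0).trans ?_
    rw [dist_comm, ← hu]
    exact hγ.infDist_le_of_parallel hX hB h1 h2 0
  have := Metric.infDist_le_infDist_add_dist (s := range γ') (x := x) (y := γ s)
  rw [hs]
  linarith

end Contracting

/-! ### Continuity of centers of convex sublevel sets -/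

section CenterContinuity

variable {X T : Type*} [MetricSpace X] [TopologicalSpace T] {F : T → X → ℝ} {R : ℝ}

/-- On the compact sphere of radius `r + ε` the function exceeds `R`, and this persists for nearby
parameters. A sublevel point outside the ball would be joined to `x₀` by a segment that crosses the
sphere inside the convex sublevel set. -/
theorem eventually_sublevel_subset_closedBall [ProperSpace X] (hX : IsCAT0 X)
    (hF : Continuous (Function.uncurry F)) (hconv : ∀ t, GeodesicallyConvex (F t)) {t : T}
    (hlt : ∃ x, F t x < R) {y : X} {r ε : ℝ} (hε : 0 < ε)
    (hsub : {x | F t x ≤ R} ⊆ Metric.closedBall y r) :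
    ∀ᶠ t' in 𝓝 t, {x | F t' x ≤ R} ⊆ Metric.closedBall y (r + ε) := by
  obtain ⟨x₀, hx₀⟩ := hlt
  have h1 : ∀ᶠ t' in 𝓝 t, ∀ x ∈ Metric.sphere y (r + ε), R < F t' x := by
    refine (isCompact_sphere y (r + ε)).eventually_forall_of_forall_eventually fun x hx => ?_
    refine (hF.tendsto (t, x)).eventually_const_lt ?_
    change R < F t x
    by_contra! hle
    have : dist x y ≤ r := hsub hle
    rw [Metric.mem_sphere] at hx
    linarith
  have h2 : ∀ᶠ t' in 𝓝 t, F t' x₀ < R :=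
    ((hF.comp (Continuous.prodMk_left x₀)).tendsto t).eventually_lt_const hx₀
  filter_upwards [h1, h2] with t' h1 h2 k hk
  by_contra hkb
  rw [Metric.mem_closedBall, not_le] at hkb
  obtain ⟨γ, hγ0, hγ1, hγ⟩ := hX.geodesic x₀ k
  have hcont : ContinuousOn (fun s => dist (γ s) y) (Icc 0 (dist x₀ k)) := by
    have hγc : ContinuousOn γ (Icc 0 (dist x₀ k)) := by
      refine LipschitzOnWith.continuousOn (K := 1) (LipschitzOnWith.of_dist_le_mul ?_)
      intro s hs u hu
      rw [hγ s hs u hu, NNReal.coe_one, one_mul, Real.dist_eq]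
    exact (continuous_id.dist continuous_const).comp_continuousOn hγc
  have hmem : r + ε ∈ Icc (dist (γ 0) y) (dist (γ (dist x₀ k)) y) := by
    rw [hγ0, hγ1]
    have : dist x₀ y ≤ r := hsub hx₀.le
    exact ⟨by linarith, hkb.le⟩
  obtain ⟨s, hs, hsy⟩ := intermediate_value_Icc dist_nonneg hcont hmem
  have e0 := hγ 0 ⟨le_rfl, dist_nonneg⟩ s hs
  have e1 := hγ s hs _ ⟨dist_nonneg, le_rfl⟩
  rw [hγ0, zero_sub, abs_neg, abs_of_nonneg hs.1] at e0
  rw [hγ1, abs_sub_comm, abs_of_nonneg (by linarith [hs.2])] at e1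
  obtain ⟨u, hu, hb⟩ := between_of_add (x := x₀) (y := k) (z := γ s) (by rw [e0, e1]; ring)
  have := (hconv t').le_max hu hb
  exact absurd (h1 _ hsy) (not_lt.2 (this.trans (max_le h2.le hk)))

/-- Moving `k` slightly towards `x₀` makes the inequality strict by convexity, and a strict
inequality is stable under small changes of the parameter. -/
theorem eventually_exists_sublevel_dist_lt (hX : IsCAT0 X)
    (hF : Continuous (Function.uncurry F)) (hconv : ∀ t, GeodesicallyConvex (F t)) {t : T}
    (hlt : ∃ x, F t x < R) {k : X} (hk : F t k ≤ R) {ε : ℝ} (hε : 0 < ε) :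
    ∀ᶠ t' in 𝓝 t, ∃ k', F t' k' ≤ R ∧ dist k k' < ε := by
  obtain ⟨x₀, hx₀⟩ := hlt
  set d := dist k x₀
  have hd : 0 ≤ d := dist_nonneg
  have hτ0 : 0 < ε / (d + ε) := by positivity
  have hτ : ε / (d + ε) ∈ Icc (0 : ℝ) 1 := ⟨hτ0.le, (div_le_one (by positivity)).2 (by linarith)⟩
  obtain ⟨z, hz⟩ := hX.exists_between k x₀ hτ
  have h1 : F t z < R := by
    have := hconv t hτ hz
    nlinarith [hτ.2]
  have h2 : dist k z < ε := by
    rw [hz.1]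
    change ε / (d + ε) * d < ε
    rw [div_mul_eq_mul_div, div_lt_iff₀ (by positivity)]
    nlinarith
  filter_upwards [((hF.comp (Continuous.prodMk_left z)).tendsto t).eventually_lt_const h1]
    with t' ht'
  exact ⟨z, ht'.le, h2⟩

/-- The centers of sublevel sets of a continuous family of convex functions vary continuously. -/
theorem continuous_isCenter [ProperSpace X] (hX : IsCAT0 X)
    (hF : Continuous (Function.uncurry F)) (hconv : ∀ t, GeodesicallyConvex (F t))
    (hlt : ∀ t, ∃ x, F t x < R) (hbdd : ∀ t, Bornology.IsBounded {x | F t x ≤ R}) {Φ : T → X}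
    (hΦ : ∀ t, IsCenter {x | F t x ≤ R} (Φ t)) : Continuous Φ := by
  rw [continuous_iff_ultrafilter]
  intro t U hU
  obtain ⟨x₀, hx₀⟩ := hlt t
  obtain ⟨r₀, hr₀⟩ := (hbdd t).subset_closedBall x₀
  have hev := eventually_sublevel_subset_closedBall hX hF hconv (hlt t) one_pos hr₀
  obtain ⟨z, hz⟩ := exists_tendsto_of_dist_le U (f := Φ) (x := x₀) (C := (r₀ + 1) + (r₀ + 1)) (by
    filter_upwards [hU hev] with t' ht'
    obtain ⟨k, hk⟩ := hlt t'
    have h1 : dist k x₀ ≤ r₀ + 1 := ht' hk.le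
    have h2 : dist k (Φ t') ≤ r₀ + 1 := hΦ t' _ _ ht' hk.le
    rw [dist_comm] at h2
    linarith [dist_triangle (Φ t') k x₀])
  -- The two preceding lemmas are the two halves of Hausdorff continuity of the sublevel sets;
  -- together they make a limit of centers a center.
  have hcen : IsCenter {x | F t x ≤ R} z := by
    intro y r hsub k hk
    rw [Metric.mem_closedBall]
    refine le_of_forall_pos_le_add fun ε hε => ?_
    have h1 := eventually_sublevel_subset_closedBall hX hF hconv (hlt t) (half_pos hε) hsub
    have h2 := eventually_exists_sublevel_dist_lt hX hF hconv (hlt t) hk (half_pos hε)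
    refine le_of_tendsto (tendsto_const_nhds.dist hz) ?_
    filter_upwards [hU h1, hU h2] with t' h1 ⟨k', hk', hkk'⟩
    have h3 : dist k' (Φ t') ≤ r + ε / 2 := hΦ t' _ _ h1 hk'
    linarith [dist_triangle k k' (Φ t')]
  rwa [hX.isCenter_unique (hbdd t) ⟨x₀, hx₀.le⟩ (hΦ t) hcen]

end CenterContinuity

/-! ### Distances to the sides of ideal triangles -/

section SideDist

variable {X : Type*} [MetricSpace X]

/-- The largest distance of `x` to a line from `a` to `b`. -/
noncomputable def sideDist (a b : Boundary X) (x : X) : ℝ :=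
  sSup {d | ∃ γ : GeodesicLine X, γ.negEnd = a ∧ γ.posEnd = b ∧ d = Metric.infDist x (range γ)}

theorem sideDist_comm (a b : Boundary X) (x : X) : sideDist a b x = sideDist b a x := by
  have key : ∀ (a b : Boundary X), {d | ∃ γ : GeodesicLine X, γ.negEnd = a ∧ γ.posEnd = b ∧
      d = Metric.infDist x (range γ)} ⊆ {d | ∃ γ : GeodesicLine X, γ.negEnd = b ∧ γ.posEnd = a ∧
      d = Metric.infDist x (range γ)} := by
    rintro a b _ ⟨γ, h1, h2, rfl⟩
    exact ⟨γ.reverse, γ.reverse_negEnd.trans h2, γ.reverse_posEnd.trans h1,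
      by rw [γ.range_reverse]⟩
  exact congrArg sSup (Subset.antisymm (key a b) (key b a))

theorem sideDist_smul (g : X ≃ᵢ X) (a b : Boundary X) (x : X) :
    sideDist (g • a) (g • b) (g x) = sideDist a b x := by
  have key : ∀ (g : X ≃ᵢ X) (a b : Boundary X) (x : X), {d | ∃ γ : GeodesicLine X,
      γ.negEnd = a ∧ γ.posEnd = b ∧ d = Metric.infDist x (range γ)} ⊆ {d | ∃ γ : GeodesicLine X,
      γ.negEnd = g • a ∧ γ.posEnd = g • b ∧ d = Metric.infDist (g x) (range γ)} := by
    rintro g a b x _ ⟨γ, rfl, rfl, rfl⟩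
    exact ⟨γ.map g, rfl, rfl, (γ.infDist_map g x).symm⟩
  have h1 := key g⁻¹ (g • a) (g • b) (g x)
  rw [inv_smul_smul, inv_smul_smul, show g⁻¹ (g x) = x from g.symm_apply_apply x] at h1
  exact congrArg sSup (Subset.antisymm h1 (key g a b x))

variable {B : ℝ}

/-- `a` and `b` are the endpoints of a `B`-contracting line. -/
def ContractingPair (B : ℝ) (a b : Boundary X) : Prop :=
  ∃ γ : GeodesicLine X, γ.negEnd = a ∧ γ.posEnd = b ∧ IsContracting B γ

variable {a b : Boundary X}

/-- The pair guarantees that the supremum is over a non-empty set. -/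
theorem ContractingPair.sideDist_le (h : ContractingPair B a b) {x : X} {r : ℝ}
    (hr : ∀ γ : GeodesicLine X, γ.negEnd = a → γ.posEnd = b → Metric.infDist x (range γ) ≤ r) :
    sideDist a b x ≤ r := by
  obtain ⟨γ₀, k1, k2, -⟩ := h
  refine csSup_le ⟨_, γ₀, k1, k2, rfl⟩ ?_
  rintro _ ⟨γ', h1', h2', rfl⟩
  exact hr γ' h1' h2'

variable [ProperSpace X]

theorem ContractingPair.infDist_le_sideDist (hX : IsCAT0 X) (hB : 0 < B)
    (h : ContractingPair B a b) {γ : GeodesicLine X} (h1 : γ.negEnd = a) (h2 : γ.posEnd = b)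
    (x : X) : Metric.infDist x (range γ) ≤ sideDist a b x := by
  obtain ⟨γ₀, k1, k2, hγ₀⟩ := h
  refine le_csSup ⟨Metric.infDist x (range γ₀) + B, ?_⟩ ⟨γ, h1, h2, rfl⟩
  rintro _ ⟨γ', h1', h2', rfl⟩
  exact hγ₀.infDist_le_add hX hB (h2'.trans k2.symm) (h1'.trans k1.symm) x

theorem ContractingPair.sideDist_le_add (hX : IsCAT0 X) (hB : 0 < B) {γ : GeodesicLine X}
    (hγ : IsContracting B γ) (h1 : γ.negEnd = a) (h2 : γ.posEnd = b) (x : X) :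
    sideDist a b x ≤ Metric.infDist x (range γ) + B :=
  ContractingPair.sideDist_le ⟨γ, h1, h2, hγ⟩ fun _ h1' h2' =>
    hγ.infDist_le_add hX hB (h2'.trans h2.symm) (h1'.trans h1.symm) x

theorem ContractingPair.geodesicallyConvex_sideDist (hX : IsCAT0 X) (hB : 0 < B)
    (h : ContractingPair B a b) : GeodesicallyConvex (sideDist a b) := by
  intro x y z t ht hz
  refine h.sideDist_le fun γ h1 h2 => (hX.geodesicallyConvex_infDist γ ht hz).trans ?_
  exact add_le_add (mul_le_mul_of_nonneg_left (h.infDist_le_sideDist hX hB h1 h2 x)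
    (sub_nonneg.2 ht.2)) (mul_le_mul_of_nonneg_left (h.infDist_le_sideDist hX hB h1 h2 y) ht.1)

theorem ContractingPair.continuous_sideDist (hX : IsCAT0 X) (hB : 0 < B)
    (h : ContractingPair B a b) : Continuous (sideDist a b) := by
  refine LipschitzWith.continuous (K := 1) (LipschitzWith.of_le_add fun x y => ?_)
  refine h.sideDist_le fun γ h1 h2 => ?_
  exact (Metric.infDist_le_infDist_add_dist (y := y)).trans
    (by linarith [h.infDist_le_sideDist hX hB h1 h2 y])

end SideDist

/-! ### Pairs and triples of limit points -/

section LimitPairs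

variable {X : Type*} [MetricSpace X] {G : Subgroup (X ≃ᵢ X)}

/-- Ordered pairs of distinct limit points. -/
def limitPairs (G : Subgroup (X ≃ᵢ X)) : SubMulAction G (limitSet G × limitSet G) where
  carrier := {p | p.1 ≠ p.2}
  smul_mem' g _ h := fun e => h (MulAction.injective g e)

theorem exists_limitSet_ne (hG : IsNonElementary G) (a : limitSet G) : ∃ b : limitSet G, a ≠ b := by
  have h : (1 : ℕ∞) < (limitSet G : Set (Boundary X)).encard :=
    lt_of_lt_of_le (by norm_num) hG.1
  obtain ⟨b, hb, hab⟩ := (one_lt_encard_iff_nontrivial.1 h).exists_ne (a : Boundary X)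
  exact ⟨⟨b, hb⟩, fun e => hab (congrArg Subtype.val e).symm⟩

/-- The largest distance of `x` to a side of an ideal triangle with vertices `t`. -/
noncomputable def triangleDist (t : limitTriples G) (x : X) : ℝ :=
  max (sideDist (t.1.1 : Boundary X) t.1.2.1 x)
    (max (sideDist (t.1.2.1 : Boundary X) t.1.2.2 x) (sideDist (t.1.2.2 : Boundary X) t.1.1 x))

theorem triangleDist_smul (g : G) (t : limitTriples G) (x : X) :
    triangleDist (g • t) ((g : X ≃ᵢ X) x) = triangleDist t x := by
  have h := fun a b : Boundary X => sideDist_smul (g : X ≃ᵢ X) a b x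
  exact congrArg₂ max (h _ _) (congrArg₂ max (h _ _) (h _ _))

variable [ProperSpace X]

theorem IsCAT0.continuousSMul_limitSet (hX : IsCAT0 X) : ContinuousSMul G (limitSet G) := by
  refine ⟨Continuous.subtype_mk ?_ _⟩
  exact hX.continuous_smul_boundary.comp ((continuous_subtype_val.comp continuous_fst).prodMk
    (continuous_subtype_val.comp continuous_snd))

theorem IsCAT0.compactSpace_limitSet [Nonempty X] (hX : IsCAT0 X)
    (h : IsClosed (limitSet G : Set (Boundary X))) : CompactSpace (limitSet G) := by
  have := hX.compactSpace_boundary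
  exact isCompact_iff_compactSpace.1 h.isCompact

theorem IsCAT0.metrizableSpace_limitSet [Nonempty X] (hX : IsCAT0 X) :
    TopologicalSpace.MetrizableSpace (limitSet G) := by
  have := hX.metrizableSpace_boundary
  exact (IsEmbedding.subtypeVal (p := (· ∈ limitSet G))).metrizableSpace

/-- Isometries preserve contraction with the same constant, so transitivity on pairs spreads the
single rank-one axis over all pairs of limit points. -/
theorem exists_contractingPair (hX : IsCAT0 X)
    (hrank : ∃ g ∈ G, IsRankOne g)
    (htrans : ∀ a b c d : limitSet G, a ≠ b → c ≠ d → ∃ g : G, g • a = c ∧ g • b = d) :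
    ∃ B > 0, ∀ a b : limitSet G, a ≠ b → ContractingPair B (a : Boundary X) (b : Boundary X) := by
  obtain ⟨g, hg, B, hB, τ, ⟨hτ, -⟩, γ, hγ, hcontr⟩ := hrank
  refine ⟨B, hB, fun a b hab => ?_⟩
  obtain ⟨k, hk1, hk2⟩ := htrans ⟨γ.negEnd, hX.negEnd_mem_limitSet hg hτ hγ⟩
    ⟨γ.posEnd, hX.posEnd_mem_limitSet hg hτ hγ⟩ a b
    (fun e => γ.negEnd_ne_posEnd (congrArg Subtype.val e)) hab
  exact ⟨γ.map (k : X ≃ᵢ X), congrArg Subtype.val hk1, congrArg Subtype.val hk2, hcontr.map _⟩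

/-- The orbit map from `G` onto the locally compact space of pairs is open, so its product with the
identity of `X` is a quotient map. Pulled back along it, the function at `(g, x)` is the one for a
fixed pair at `g⁻¹ x`, which is continuous. -/
theorem continuous_sideDist_pairs (hX : IsCAT0 X) (hclosed : IsClosed (G : Set (X ≃ᵢ X)))
    (hΛ : IsClosed (limitSet G : Set (Boundary X)))
    (htrans : ∀ a b c d : limitSet G, a ≠ b → c ≠ d → ∃ g : G, g • a = c ∧ g • b = d)
    {B : ℝ} (hB : 0 < B)
    (hpair : ∀ a b : limitSet G, a ≠ b → ContractingPair B (a : Boundary X) (b : Boundary X)) :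
    Continuous fun q : limitPairs G × X =>
      sideDist (q.1.1.1 : Boundary X) (q.1.1.2 : Boundary X) q.2 := by
  rcases isEmpty_or_nonempty (limitPairs G × X) with he | ⟨⟨p₀, x₀⟩⟩
  · exact continuous_of_const fun x => he.elim x
  have : Nonempty X := ⟨x₀⟩
  have := hX.compactSpace_limitSet hΛ
  have := hX.metrizableSpace_limitSet (G := G)
  have := hX.continuousSMul_limitSet (G := G)
  have := sigmaCompactSpace_subgroup hclosed
  have hopen : IsOpen (limitPairs G : Set (limitSet G × limitSet G)) :=
    isOpen_ne_fun continuous_fst continuous_snd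
  have : LocallyCompactSpace (limitPairs G) := hopen.locallyCompactSpace
  have : MulAction.IsPretransitive G (limitPairs G) := by
    refine ⟨fun p q => ?_⟩
    obtain ⟨g, h1, h2⟩ := htrans p.1.1 p.1.2 q.1.1 q.1.2 p.2 q.2
    exact ⟨g, Subtype.ext (Prod.ext h1 h2)⟩
  have hφ : IsOpenMap fun q : G × X => (q.1 • p₀, q.2) :=
    (isOpenMap_smul_of_sigmaCompact p₀).prodMap IsOpenMap.id
  have hφc : Continuous fun q : G × X => (q.1 • p₀, q.2) :=
    (continuous_fst.smul continuous_const).prodMk continuous_snd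
  have hφs : Function.Surjective fun q : G × X => (q.1 • p₀, q.2) := by
    rintro ⟨p, x⟩
    obtain ⟨g, rfl⟩ := MulAction.exists_smul_eq G p₀ p
    exact ⟨(g, x), rfl⟩
  rw [(hφ.isQuotientMap hφc hφs).continuous_iff]
  have heq : (fun q : limitPairs G × X =>
      sideDist (q.1.1.1 : Boundary X) (q.1.1.2 : Boundary X) q.2) ∘
      (fun q : G × X => (q.1 • p₀, q.2)) = fun q : G × X =>
      sideDist (p₀.1.1 : Boundary X) (p₀.1.2 : Boundary X) (((q.1⁻¹ : G) : X ≃ᵢ X) q.2) := by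
    funext q
    have h := sideDist_smul (q.1 : X ≃ᵢ X) (p₀.1.1 : Boundary X) (p₀.1.2 : Boundary X)
      (((q.1⁻¹ : G) : X ≃ᵢ X) q.2)
    have e : (q.1 : X ≃ᵢ X) (((q.1⁻¹ : G) : X ≃ᵢ X) q.2) = q.2 :=
      (q.1 : X ≃ᵢ X).apply_symm_apply q.2
    rw [e] at h
    exact h
  rw [heq]
  refine ((hpair _ _ p₀.2).continuous_sideDist hX hB).comp ?_
  exact continuous_iso_apply_prod.comp
    ((continuous_subtype_val.comp continuous_fst.inv).prodMk continuous_snd)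

theorem quasiCenters_eq (hX : IsCAT0 X) {B : ℝ} (hB : 0 < B)
    (hpair : ∀ a b : limitSet G, a ≠ b → ContractingPair B (a : Boundary X) (b : Boundary X))
    (R : ℝ) (t : limitTriples G) : quasiCenters R t = {x | triangleDist t x ≤ R} := by
  obtain ⟨⟨a, b, c⟩, hab, hbc, hca⟩ := t
  change a ≠ b at hab
  change b ≠ c at hbc
  change c ≠ a at hca
  ext x
  constructor
  · intro h
    refine (max_le ?_ (max_le ?_ ?_) : max (sideDist (a : Boundary X) b x)
      (max (sideDist (b : Boundary X) c x) (sideDist (c : Boundary X) a x)) ≤ R)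
    · exact (hpair _ _ hab).sideDist_le fun γ h1 h2 => h γ (Or.inl h1) (Or.inr (Or.inl h2))
    · exact (hpair _ _ hbc).sideDist_le fun γ h1 h2 => h γ (Or.inr (Or.inl h1)) (Or.inr (Or.inr h2))
    · exact (hpair _ _ hca).sideDist_le fun γ h1 h2 => h γ (Or.inr (Or.inr h1)) (Or.inl h2)
  · intro h γ h1 h2
    have h' : max (sideDist (a : Boundary X) b x)
      (max (sideDist (b : Boundary X) c x) (sideDist (c : Boundary X) a x)) ≤ R := h
    rw [max_le_iff, max_le_iff] at h'
    obtain ⟨k1, k2, k3⟩ := h'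
    have hγ := γ.negEnd_ne_posEnd
    rcases h1 with h1 | h1 | h1 <;> rcases h2 with h2 | h2 | h2 <;>
      first
      | exact absurd (h1.trans h2.symm) hγ
      | exact ((hpair _ _ hab).infDist_le_sideDist hX hB h1 h2 x).trans k1
      | exact ((hpair _ _ hbc).infDist_le_sideDist hX hB h1 h2 x).trans k2
      | exact ((hpair _ _ hca).infDist_le_sideDist hX hB h1 h2 x).trans k3
      | exact ((hpair _ _ hab.symm).infDist_le_sideDist hX hB h1 h2 x).trans
          ((sideDist_comm _ _ x).trans_le k1)
      | exact ((hpair _ _ hbc.symm).infDist_le_sideDist hX hB h1 h2 x).trans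
          ((sideDist_comm _ _ x).trans_le k2)
      | exact ((hpair _ _ hca.symm).infDist_le_sideDist hX hB h1 h2 x).trans
          ((sideDist_comm _ _ x).trans_le k3)

theorem geodesicallyConvex_triangleDist (hX : IsCAT0 X) {B : ℝ} (hB : 0 < B)
    (hpair : ∀ a b : limitSet G, a ≠ b → ContractingPair B (a : Boundary X) (b : Boundary X))
    (t : limitTriples G) : GeodesicallyConvex (triangleDist t) := by
  have hmax : ∀ {f g : X → ℝ}, GeodesicallyConvex f → GeodesicallyConvex g →
      GeodesicallyConvex fun x => max (f x) (g x) := by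
    intro f g hf hg x y z s hs hz
    have h1 := sub_nonneg.2 hs.2
    refine max_le ((hf hs hz).trans ?_) ((hg hs hz).trans ?_) <;>
      refine add_le_add (mul_le_mul_of_nonneg_left ?_ h1) (mul_le_mul_of_nonneg_left ?_ hs.1) <;>
      first
      | exact le_max_left _ _
      | exact le_max_right _ _
  exact hmax ((hpair _ _ t.2.1).geodesicallyConvex_sideDist hX hB)
    (hmax ((hpair _ _ t.2.2.1).geodesicallyConvex_sideDist hX hB)
      ((hpair _ _ t.2.2.2).geodesicallyConvex_sideDist hX hB))

theorem continuous_triangleDist (hX : IsCAT0 X) (hclosed : IsClosed (G : Set (X ≃ᵢ X)))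
    (hΛ : IsClosed (limitSet G : Set (Boundary X)))
    (htrans : ∀ a b c d : limitSet G, a ≠ b → c ≠ d → ∃ g : G, g • a = c ∧ g • b = d)
    {B : ℝ} (hB : 0 < B)
    (hpair : ∀ a b : limitSet G, a ≠ b → ContractingPair B (a : Boundary X) (b : Boundary X)) :
    Continuous (Function.uncurry (triangleDist (G := G))) := by
  have h := continuous_sideDist_pairs hX hclosed hΛ htrans hB hpair
  have hval : Continuous fun q : limitTriples G × X =>
      (q.1 : limitSet G × limitSet G × limitSet G) :=
    continuous_subtype_val.comp continuous_fst
  have h1 : Continuous fun q : limitTriples G × X => q.1.1.1 := continuous_fst.comp hval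
  have h2 : Continuous fun q : limitTriples G × X => q.1.1.2.1 :=
    continuous_fst.comp (continuous_snd.comp hval)
  have h3 : Continuous fun q : limitTriples G × X => q.1.1.2.2 :=
    continuous_snd.comp (continuous_snd.comp hval)
  have k1 : Continuous fun q : limitTriples G × X =>
      ((⟨(q.1.1.1, q.1.1.2.1), q.1.2.1⟩ : limitPairs G), q.2) :=
    ((h1.prodMk h2).subtype_mk _).prodMk continuous_snd
  have k2 : Continuous fun q : limitTriples G × X =>
      ((⟨(q.1.1.2.1, q.1.1.2.2), q.1.2.2.1⟩ : limitPairs G), q.2) :=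
    ((h2.prodMk h3).subtype_mk _).prodMk continuous_snd
  have k3 : Continuous fun q : limitTriples G × X =>
      ((⟨(q.1.1.2.2, q.1.1.1), q.1.2.2.2⟩ : limitPairs G), q.2) :=
    ((h3.prodMk h1).subtype_mk _).prodMk continuous_snd
  exact (h.comp k1).max ((h.comp k2).max (h.comp k3))

/-- `12 * B` for one contracting line on each side, and `B` more for all its parallels. -/
theorem exists_triangleDist_le (hX : IsCAT0 X) {B : ℝ} (hB : 0 < B)
    (hpair : ∀ a b : limitSet G, a ≠ b → ContractingPair B (a : Boundary X) (b : Boundary X))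
    (t : limitTriples G) : ∃ x, triangleDist t x ≤ 13 * B := by
  obtain ⟨⟨a, b, c⟩, hab, hbc, hca⟩ := t
  obtain ⟨γ, hγa, hγb, hγ⟩ := hpair _ _ hab
  obtain ⟨σ, hσc, hσb, hσ⟩ := hpair _ _ hbc.symm
  obtain ⟨ρ, hρc, hρa, hρ⟩ := hpair _ _ hca
  have hne : ∀ {u v : limitSet G}, u ≠ v → (u : Boundary X) ≠ v := fun h e => h (Subtype.ext e)
  obtain ⟨p, s, u, hs, hu⟩ := hγ.exists_center hX hB (σ := σ) (ρ := ρ) (hσb.trans hγb.symm)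
    (hρa.trans hγa.symm) (hσc.trans hρc.symm) (by rw [hσc, hγa]; exact hne hca)
    (by rw [hσc, hγb]; exact hne hbc.symm)
  rw [dist_comm] at hs hu
  refine ⟨γ p, max_le ?_ (max_le ?_ ?_)⟩
  · have := ContractingPair.sideDist_le_add hX hB hγ hγa hγb (γ p)
    rw [Metric.infDist_zero_of_mem (mem_range_self p)] at this
    exact this.trans (by linarith)
  · rw [sideDist_comm]
    refine (ContractingPair.sideDist_le_add hX hB hσ hσc hσb (γ p)).trans ?_
    linarith [σ.infDist_le (γ p) s]
  · refine (ContractingPair.sideDist_le_add hX hB hρ hρc hρa (γ p)).trans ?_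
    linarith [ρ.infDist_le (γ p) u]

/-- The foot of such a point on `γ` is within `2 * R` of both other sides. Since `γ` moves away from
`ρ` at one end and from `σ` at the other, the foot stays in a bounded segment. -/
theorem isBounded_triangleDist (hX : IsCAT0 X) {B : ℝ} (hB : 0 < B)
    (hpair : ∀ a b : limitSet G, a ≠ b → ContractingPair B (a : Boundary X) (b : Boundary X))
    (R : ℝ) (t : limitTriples G) : Bornology.IsBounded {x | triangleDist t x ≤ R} := by
  obtain ⟨⟨a, b, c⟩, hab, hbc, hca⟩ := t
  change a ≠ b at hab
  change b ≠ c at hbc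
  change c ≠ a at hca
  obtain ⟨γ, hγa, hγb, -⟩ := hpair _ _ hab
  obtain ⟨σ, hσc, hσb, -⟩ := hpair _ _ hbc.symm
  obtain ⟨ρ, hρc, hρa, -⟩ := hpair _ _ hca
  have hne : ∀ {u v : limitSet G}, u ≠ v → (u : Boundary X) ≠ v := fun h e => h (Subtype.ext e)
  obtain ⟨N₁, hN₁⟩ := hX.exists_forall_lt_dist (α := γ) (β := ρ)
    (by rw [hγb, hρa]; exact hne hab.symm) (by rw [hγb, hρc]; exact hne hbc) (2 * R)
  obtain ⟨N₂, hN₂⟩ := hX.exists_forall_lt_dist (α := γ.reverse) (β := σ)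
    (by rw [γ.reverse_posEnd, hγa, hσb]; exact hne hab)
    (by rw [γ.reverse_posEnd, hγa, hσc]; exact hne hca.symm) (2 * R)
  refine (Metric.isBounded_closedBall (x := γ 0) (r := R + max N₁ N₂)).subset fun x hx => ?_
  have h' : max (sideDist (a : Boundary X) b x)
    (max (sideDist (b : Boundary X) c x) (sideDist (c : Boundary X) a x)) ≤ R := hx
  rw [max_le_iff, max_le_iff, sideDist_comm (b : Boundary X)] at h'
  obtain ⟨k1, k2, k3⟩ := h'
  have e1 := ((hpair _ _ hab).infDist_le_sideDist hX hB hγa hγb x).trans k1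
  have e2 := ((hpair _ _ hbc.symm).infDist_le_sideDist hX hB hσc hσb x).trans k2
  have e3 := ((hpair _ _ hca).infDist_le_sideDist hX hB hρc hρa x).trans k3
  obtain ⟨p, hp⟩ := γ.exists_infDist x
  obtain ⟨s, hs⟩ := σ.exists_infDist x
  obtain ⟨u, hu⟩ := ρ.exists_infDist x
  rw [hp] at e1
  rw [hs] at e2
  rw [hu] at e3
  have hp1 : p ≤ N₁ := by
    by_contra! hlt
    have := hN₁ p hlt.le u
    have h3 := dist_triangle (γ p) x (ρ u)
    rw [dist_comm (γ p) x] at h3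
    linarith
  have hp2 : -p ≤ N₂ := by
    by_contra! hlt
    have := hN₂ (-p) hlt.le s
    have h3 := dist_triangle (γ p) x (σ s)
    rw [dist_comm (γ p) x] at h3
    rw [γ.reverse_apply, neg_neg] at this
    linarith
  rw [Metric.mem_closedBall]
  have h4 := dist_triangle x (γ p) (γ 0)
  rw [γ.dist_eq, sub_zero] at h4
  have h5 : |p| ≤ max N₁ N₂ := abs_le.2 ⟨by linarith [le_max_right N₁ N₂],
    hp1.trans (le_max_left _ _)⟩
  linarith

/-- Triples of limit points have equivariant continuous centers. -/
theorem exists_continuous_center (hX : IsCAT0 X) (hclosed : IsClosed (G : Set (X ≃ᵢ X)))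
    (hΛ : IsClosed (limitSet G : Set (Boundary X)))
    (htrans : ∀ a b c d : limitSet G, a ≠ b → c ≠ d → ∃ g : G, g • a = c ∧ g • b = d)
    {B : ℝ} (hB : 0 < B)
    (hpair : ∀ a b : limitSet G, a ≠ b → ContractingPair B (a : Boundary X) (b : Boundary X)) :
    ∃ R > 0, ∃ Φ : limitTriples G → X, Continuous Φ ∧
      (∀ (g : G) (t : limitTriples G), Φ (g • t) = (g : X ≃ᵢ X) (Φ t)) ∧
      ∀ t : limitTriples G, (quasiCenters R t).Nonempty ∧ IsCompact (quasiCenters R t) ∧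
        IsCenter (quasiCenters R t) (Φ t) := by
  have hF := continuous_triangleDist hX hclosed hΛ htrans hB hpair
  have hlt : ∀ t : limitTriples G, ∃ x, triangleDist t x < 14 * B := fun t => by
    obtain ⟨x, hx⟩ := exists_triangleDist_le hX hB hpair t
    exact ⟨x, by linarith⟩
  have hbdd := isBounded_triangleDist hX hB hpair (14 * B)
  have hne : ∀ t : limitTriples G, {x | triangleDist t x ≤ 14 * B}.Nonempty := fun t => by
    obtain ⟨x, hx⟩ := hlt t
    exact ⟨x, hx.le⟩
  choose Φ hΦ using fun t : limitTriples G => IsCAT0.exists_isCenter (hbdd t) (hne t)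
  refine ⟨14 * B, by linarith, Φ, ?_, fun g t => ?_, fun t => ?_⟩
  · exact continuous_isCenter hX hF (geodesicallyConvex_triangleDist hX hB hpair) hlt hbdd hΦ
  -- Equivariance follows from uniqueness: the image of a center under `g` is a center of the
  -- translated set.
  · refine hX.isCenter_unique (hbdd _) (hne _) (hΦ _) fun y r hsub z hz => ?_
    have hz' : triangleDist t ((g : X ≃ᵢ X).symm z) ≤ 14 * B := by
      rw [← triangleDist_smul g, IsometryEquiv.apply_symm_apply]
      exact hz
    have := hΦ t ((g : X ≃ᵢ X).symm y) r (fun w hw => ?_) hz'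
    · rw [Metric.mem_closedBall, ← (g : X ≃ᵢ X).dist_eq, IsometryEquiv.apply_symm_apply] at this
      exact this
    · have hw' : triangleDist (g • t) ((g : X ≃ᵢ X) w) ≤ 14 * B := by
        rw [triangleDist_smul]
        exact hw
      have := hsub hw'
      rw [Metric.mem_closedBall] at this ⊢
      rwa [← (g : X ≃ᵢ X).dist_eq, IsometryEquiv.apply_symm_apply]
  · rw [quasiCenters_eq hX hB hpair]
    refine ⟨hne t, ?_, hΦ t⟩
    refine Metric.isCompact_of_isClosed_isBounded ?_ (hbdd t)
    exact isClosed_le (hF.comp (Continuous.prodMk_right t)) continuous_const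

end LimitPairs

/-! ### Tameness from closed orbits -/

/-- A continuous action with closed orbits on a second countable space is tame. -/
theorem isTameAction_of_isClosed_orbit {H S : Type*} [Group H] [TopologicalSpace S]
    [SecondCountableTopology S] [MulAction H S] [ContinuousConstSMul H S]
    (h : ∀ s : S, IsClosed (MulAction.orbit H s)) : IsTameAction H S := by
  refine ⟨fun s => (h s).isLocallyClosed, ?_⟩
  let π : S → MulAction.orbitRel.Quotient H S := Quotient.mk (MulAction.orbitRel H S)
  have hπ : ∀ {s s' : S}, π s = π s' ↔ s ∈ MulAction.orbit H s' := Quotient.eq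
  refine @MeasurableSpace.CountablySeparated.mk _ ((borel S).map π)
    (@HasCountableSeparatingOn.mk _ _ _ ?_)
  -- The separating sets are images of basic open sets. Their saturations are open, and for a closed
  -- orbit some basic neighbourhood of a point off it has image avoiding it.
  refine ⟨(fun u => π '' u) '' TopologicalSpace.countableBasis S,
    (TopologicalSpace.countable_countableBasis S).image _, ?_, ?_⟩
  · rintro _ ⟨u, hu, rfl⟩
    change MeasurableSet[borel S] (π ⁻¹' (π '' u))
    have hopen : IsOpen (π ⁻¹' (π '' u)) := by
      have : π ⁻¹' (π '' u) = ⋃ g : H, (fun s => g • s) ⁻¹' u := by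
        ext s
        rw [mem_iUnion]
        constructor
        · rintro ⟨s', hs', he⟩
          obtain ⟨g, hg⟩ := hπ.1 he
          have hg' : g • s = s' := hg
          exact ⟨g, by rw [mem_preimage, hg']; exact hs'⟩
        · rintro ⟨g, hg⟩
          exact ⟨g • s, hg, hπ.2 ⟨g, rfl⟩⟩
      rw [this]
      exact isOpen_iUnion fun g =>
        (TopologicalSpace.isOpen_of_mem_countableBasis hu).preimage (continuous_const_smul g)
    exact MeasurableSpace.measurableSet_generateFrom hopen
  · intro p _ q _ hpq
    obtain ⟨s, rfl⟩ := Quotient.exists_rep p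
    obtain ⟨s', rfl⟩ := Quotient.exists_rep q
    by_contra hne
    have hs : s ∈ (MulAction.orbit H s')ᶜ := fun hmem => hne (hπ.2 hmem)
    obtain ⟨u, hu, hsu, hsub⟩ :=
      (TopologicalSpace.isBasis_countableBasis S).exists_subset_of_mem_open
      hs (h s').isOpen_compl
    obtain ⟨w, hw, he⟩ := (hpq _ ⟨u, hu, rfl⟩).1 ⟨s, hsu, rfl⟩
    exact hsub hw (hπ.1 he)

/-! ### Supports and weak convergence of measures on the limit set -/

section Proper

variable {X : Type*} [MetricSpace X] {G : Subgroup (X ≃ᵢ X)}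

theorem continuous_smul_measure_const (g : G) :
    Continuous fun μ : ProbabilityMeasure (limitSet G) => g • μ :=
  ProbabilityMeasure.continuous_map (limitSet_continuous_smul g)

/-- By second countability a set of positive measure contains a support point. Removing the points
already found leaves positive measure until there are three. -/
theorem exists_support_triple [SecondCountableTopology (limitSet G)]
    {μ : ProbabilityMeasure (limitSet G)} (hμ : μ ∈ measuresGeThree G) :
    ∃ t ∈ limitTriples G, ∀ U : Set (limitSet G), IsOpen U →
      (t.1 ∈ U ∨ t.2.1 ∈ U ∨ t.2.2 ∈ U) → 0 < (μ : Measure (limitSet G)) U := by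
  have key : ∀ a b : limitSet G, ∃ p, p ≠ a ∧ p ≠ b ∧ ∀ U : Set (limitSet G), IsOpen U → p ∈ U →
      0 < (μ : Measure (limitSet G)) U := by
    intro a b
    obtain ⟨p, hp, h⟩ := exists_mem_forall_mem_nhdsWithin_pos_measure (hμ a b)
    refine ⟨p, fun e => hp (Or.inl e), fun e => hp (Or.inr e), fun U hU hpU => ?_⟩
    exact h U (mem_nhdsWithin_of_mem_nhds (hU.mem_nhds hpU))
  obtain ⟨a⟩ : Nonempty (limitSet G) := μ.nonempty
  obtain ⟨p, -, -, hp⟩ := key a a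
  obtain ⟨q, hqp, -, hq⟩ := key p p
  obtain ⟨r, hrp, hrq, hr⟩ := key p q
  refine ⟨(p, q, r), ⟨hqp.symm, hrq.symm, hrp⟩, ?_⟩
  rintro U hU (h | h | h)
  exacts [hp U hU h, hq U hU h, hr U hU h]

/-- Portmanteau: the mass of an open set is lower semicontinuous. -/
theorem eventually_lt_measure [TopologicalSpace.MetrizableSpace (limitSet G)]
    (μ : ProbabilityMeasure (limitSet G))
    {U : Set (limitSet G)} (hU : IsOpen U) {δ : ENNReal} (hδ : δ < (μ : Measure (limitSet G)) U) :
    ∀ᶠ ν : ProbabilityMeasure (limitSet G) in 𝓝 μ, δ < (ν : Measure (limitSet G)) U := by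
  have := ProbabilityMeasure.le_liminf_measure_open_of_tendsto (tendsto_id (x := 𝓝 μ)) hU
  exact eventually_lt_of_lt_liminf (hδ.trans_le this)

variable [ProperSpace X]

theorem exists_tendsto_subgroup (hclosed : IsClosed (G : Set (X ≃ᵢ X))) {ι : Type*}
    (U : Ultrafilter ι) {g : ι → G} {x : X} {C : ℝ}
    (h : ∀ᶠ i in U, dist ((g i : X ≃ᵢ X) x) x ≤ C) : ∃ g₀, Tendsto g U (𝓝 g₀) := by
  obtain ⟨g₀, -, hg₀⟩ := (isCompact_subgroup hclosed x C).ultrafilter_le_nhds (U.map g)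
    (le_principal_iff.2 h)
  exact ⟨g₀, hg₀⟩

/-! ### Properness of the action on triples -/

/-- If `q.2` and `q.1 • q.2` converge, then so do their images under `Φ`. By equivariance the
displacement of `Φ t` under `q.1` is then bounded, so `q.1` converges along the ultrafilter. -/
theorem properSMul_limitTriples (hX : IsCAT0 X) (hclosed : IsClosed (G : Set (X ≃ᵢ X)))
    {Φ : limitTriples G → X} (hΦ : Continuous Φ)
    (hequi : ∀ (g : G) (t : limitTriples G), Φ (g • t) = (g : X ≃ᵢ X) (Φ t)) :
    ProperSMul G (limitTriples G) := by
  have := hX.continuousSMul_limitSet (G := G)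
  refine ⟨isProperMap_iff_ultrafilter.2 ⟨continuous_smul.prodMk continuous_snd, ?_⟩⟩
  rintro U ⟨t', t⟩ hU
  have h1 : Tendsto (fun q : G × limitTriples G => q.1 • q.2) U (𝓝 t') :=
    (continuous_fst.tendsto (t', t)).comp hU
  have h2 : Tendsto (fun q : G × limitTriples G => q.2) U (𝓝 t) :=
    (continuous_snd.tendsto (t', t)).comp hU
  have h3 := (hΦ.tendsto t').comp h1
  have h4 := (hΦ.tendsto t).comp h2
  obtain ⟨g₀, hg₀⟩ := exists_tendsto_subgroup hclosed U (g := Prod.fst) (x := Φ t)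
    (C := 1 + 1 + dist (Φ t') (Φ t)) (by
      filter_upwards [h3.eventually (Metric.ball_mem_nhds _ one_pos),
        h4.eventually (Metric.ball_mem_nhds _ one_pos)] with q hq1 hq2
      have e1 : dist (Φ (q.1 • q.2)) (Φ t') < 1 := hq1
      have e2 : dist (Φ q.2) (Φ t) < 1 := hq2
      rw [hequi] at e1
      have e3 := dist_triangle4 ((q.1 : X ≃ᵢ X) (Φ t)) ((q.1 : X ≃ᵢ X) (Φ q.2)) (Φ t') (Φ t)
      rw [IsometryEquiv.dist_eq, dist_comm (Φ t) (Φ q.2)] at e3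
      linarith)
  have hlim : Tendsto id (U : Filter (G × limitTriples G)) (𝓝 (g₀, t)) := hg₀.prodMk_nhds h2
  refine ⟨(g₀, t), ?_, hlim⟩
  have hne : Nonempty X := ⟨Φ t⟩
  have := hX.metrizableSpace_limitSet (G := G)
  have h5 : Tendsto (fun q : G × limitTriples G => q.1 • q.2) U (𝓝 (g₀ • t)) :=
    (continuous_smul.tendsto (g₀, t)).comp hlim
  rw [tendsto_nhds_unique h5 h1]

/-! ### The action on measures -/

/-- For a test function `f`, compactness of the limit set makes `f (g • ξ)` depend on `g`
continuously in the uniform norm, by currying. -/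
theorem continuous_smul_measure (hX : IsCAT0 X) [CompactSpace (limitSet G)]
    (μ : ProbabilityMeasure (limitSet G)) : Continuous fun g : G => g • μ := by
  have := hX.continuousSMul_limitSet (G := G)
  refine continuous_iff_continuousAt.2 fun g₀ => ?_
  rw [ContinuousAt, ProbabilityMeasure.tendsto_iff_forall_integral_tendsto]
  intro f
  have hgint : ∀ g : G, ∫ ξ, f ξ ∂((g • μ : ProbabilityMeasure (limitSet G)) : Measure (limitSet G))
      = ∫ ξ, f (g • ξ) ∂(μ : Measure (limitSet G)) := by
    intro g
    rw [toMeasure_smul, integral_map (limitSet_continuous_smul g).measurable.aemeasurable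
      f.continuous.measurable.aestronglyMeasurable]
  simp only [hgint]
  let F : C(G × limitSet G, ℝ) := ⟨fun q => f (q.1 • q.2), f.continuous.comp continuous_smul⟩
  have hF : ∀ g : G, Integrable (fun ξ => f (g • ξ)) (μ : Measure (limitSet G)) := fun g =>
    (f.compContinuous ⟨_, limitSet_continuous_smul g⟩).integrable _
  rw [Metric.tendsto_nhds]
  intro ε hε
  have hcurry := (F.curry.continuous.tendsto g₀).eventually (Metric.ball_mem_nhds _ (half_pos hε))
  filter_upwards [hcurry] with g hg
  have hg' : dist (F.curry g) (F.curry g₀) < ε / 2 := hg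
  rw [dist_eq_norm, ← integral_sub (hF g) (hF g₀)]
  refine lt_of_le_of_lt (norm_integral_le_of_norm_le_const (C := ε / 2)
    (Eventually.of_forall fun ξ => ?_)) ?_
  · rw [← dist_eq_norm]
    exact ((ContinuousMap.dist_apply_le_dist (f := F.curry g) (g := F.curry g₀) ξ).trans hg'.le)
  · simp only [probReal_univ, mul_one]
    linarith

/-- Measures that are not concentrated on two points cannot be moved by unbounded isometries
towards such measures. -/
theorem exists_nhds_forall_dist_le [Nonempty X] (hX : IsCAT0 X) [CompactSpace (limitSet G)]
    {Φ : limitTriples G → X} (hΦ : Continuous Φ)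
    (hequi : ∀ (g : G) (t : limitTriples G), Φ (g • t) = (g : X ≃ᵢ X) (Φ t))
    (μ : ProbabilityMeasure (limitSet G)) {μ' : ProbabilityMeasure (limitSet G)}
    (hμ' : μ' ∈ measuresGeThree G) (x : X) :
    ∃ C : ℝ, ∀ᶠ ν in 𝓝 μ', ∀ g : G, g • μ = ν → dist ((g : X ≃ᵢ X) x) x ≤ C := by
  have := hX.metrizableSpace_limitSet (G := G)
  let _ := TopologicalSpace.metrizableSpaceMetric (limitSet G)
  have : SecondCountableTopology (limitSet G) := inferInstance
  have hT : IsOpen (limitTriples G : Set (limitSet G × limitSet G × limitSet G)) := by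
    refine (isOpen_ne_fun continuous_fst (continuous_fst.comp continuous_snd)).inter
      ((isOpen_ne_fun (continuous_fst.comp continuous_snd)
        (continuous_snd.comp continuous_snd)).inter
        (isOpen_ne_fun (continuous_snd.comp continuous_snd) continuous_fst))
  obtain ⟨t₀, ht₀, hpos⟩ := exists_support_triple hμ'
  set y := Φ ⟨t₀, ht₀⟩ with hy
  -- Triples with center near `y`. A product neighbourhood of the support triple inside `V` is
  -- charged by all measures close to `μ'`.
  set V : Set (limitSet G × limitSet G × limitSet G) :=
    Subtype.val '' {t : limitTriples G | dist (Φ t) y < 1} with hV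
  have hVopen : IsOpen V :=
    hT.isOpenMap_subtype_val _ (isOpen_lt (hΦ.dist continuous_const) continuous_const)
  have ht₀V : t₀ ∈ V := ⟨⟨t₀, ht₀⟩, by simp [hy], rfl⟩
  obtain ⟨U₁, W, hU₁, hW, ht1, htW, hsub⟩ := isOpen_prod_iff.1 hVopen t₀.1 t₀.2 ht₀V
  obtain ⟨U₂, U₃, hU₂, hU₃, ht2, ht3, hsub'⟩ := isOpen_prod_iff.1 hW t₀.2.1 t₀.2.2 htW
  have p1 := hpos U₁ hU₁ (Or.inl ht1)
  have p2 := hpos U₂ hU₂ (Or.inr (Or.inl ht2))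
  have p3 := hpos U₃ hU₃ (Or.inr (Or.inr ht3))
  have hhalf : ∀ {U : Set (limitSet G)}, 0 < (μ' : Measure (limitSet G)) U →
      (μ' : Measure (limitSet G)) U / 2 < (μ' : Measure (limitSet G)) U := fun h =>
    ENNReal.half_lt_self h.ne' (measure_ne_top _ _)
  set m : Measure (limitSet G × limitSet G × limitSet G) :=
    (μ : Measure (limitSet G)).prod ((μ : Measure (limitSet G)).prod (μ : Measure (limitSet G)))
    with hm
  -- Triples with center far from `x`. They decrease to the empty set, so their mass tends to 0;
  -- triples with repeated entries are not counted here.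
  set A : ℕ → Set (limitSet G × limitSet G × limitSet G) := fun n =>
    Subtype.val '' {t : limitTriples G | (n : ℝ) < dist (Φ t) x} with hA
  have hAopen : ∀ n, IsOpen (A n) := fun n =>
    hT.isOpenMap_subtype_val _ (isOpen_lt continuous_const (hΦ.dist continuous_const))
  have hAanti : Antitone A := by
    intro n k hnk
    refine image_mono fun t ht => ?_
    have ht' : (k : ℝ) < dist (Φ t) x := ht
    exact lt_of_le_of_lt (Nat.cast_le.2 hnk) ht'
  have hAempty : ⋂ n, A n = ∅ := by
    refine eq_empty_of_forall_notMem fun t ht => ?_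
    obtain ⟨s, -, rfl⟩ := mem_iInter.1 ht 0
    obtain ⟨n, hn⟩ := exists_nat_gt (dist (Φ s) x)
    obtain ⟨s', hs', he⟩ := mem_iInter.1 ht n
    rw [Subtype.ext he] at hs'
    exact lt_asymm hn hs'
  have hAlim : Tendsto (fun n => m (A n)) atTop (𝓝 0) := by
    have := tendsto_measure_iInter_atTop (μ := m) (s := A)
      (fun n => (hAopen n).measurableSet.nullMeasurableSet) hAanti ⟨0, measure_ne_top _ _⟩
    rwa [hAempty, measure_empty] at this
  set δ := (μ' : Measure (limitSet G)) U₁ / 2 * ((μ' : Measure (limitSet G)) U₂ / 2 *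
    ((μ' : Measure (limitSet G)) U₃ / 2)) with hδ
  have hδ0 : 0 < δ := by
    have h2 : ∀ {a : ENNReal}, 0 < a → a / 2 ≠ 0 := fun h => (ENNReal.half_pos h.ne').ne'
    exact pos_iff_ne_zero.2 (mul_ne_zero (h2 p1) (mul_ne_zero (h2 p2) (h2 p3)))
  obtain ⟨n, hn⟩ := (hAlim.eventually_lt_const hδ0).exists
  refine ⟨n + 1 + dist y x, ?_⟩
  filter_upwards [eventually_lt_measure μ' hU₁ (hhalf p1), eventually_lt_measure μ' hU₂ (hhalf p2),
    eventually_lt_measure μ' hU₃ (hhalf p3)] with ν h1 h2 h3 g hg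
  subst hg
  have hpre : ∀ {U : Set (limitSet G)}, IsOpen U →
      ((g • μ : ProbabilityMeasure (limitSet G)) : Measure (limitSet G)) U
        = (μ : Measure (limitSet G)) ((fun ξ => g • ξ) ⁻¹' U) := fun hU => by
    rw [toMeasure_smul, Measure.map_apply (limitSet_continuous_smul g).measurable hU.measurableSet]
  rw [hpre hU₁] at h1
  rw [hpre hU₂] at h2
  rw [hpre hU₃] at h3
  set E := ((fun ξ : limitSet G => g • ξ) ⁻¹' U₁) ×ˢ
    (((fun ξ : limitSet G => g • ξ) ⁻¹' U₂) ×ˢ ((fun ξ : limitSet G => g • ξ) ⁻¹' U₃))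
  -- `E` consists of the triples that `g` moves into the product neighbourhood. Its mass exceeds
  -- that of `A n`, so some triple in `E` has its center within `n` of `x` and is moved to one with
  -- center within 1 of `y`.
  have hE : δ ≤ m E := by
    rw [hm, Measure.prod_prod, Measure.prod_prod]
    exact mul_le_mul' h1.le (mul_le_mul' h2.le h3.le)
  obtain ⟨t, htE, htA⟩ : ∃ t ∈ E, t ∉ A n := by
    by_contra! hcon
    exact absurd (measure_mono hcon) (not_le.2 (hn.trans_le hE))
  obtain ⟨htE1, htE2, htE3⟩ := htE
  obtain ⟨s, hs, hst⟩ : g • t ∈ V := hsub ⟨htE1, hsub' ⟨htE2, htE3⟩⟩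
  have hsT : t = (g⁻¹ • s : limitTriples G) := by
    rw [SubMulAction.val_smul, hst, inv_smul_smul]
  have e1 : dist (Φ (g⁻¹ • s)) x ≤ n := by
    by_contra! hlt
    exact htA ⟨g⁻¹ • s, hlt, hsT.symm⟩
  have e2 : dist (Φ s) y < 1 := hs
  have e3 : (g : X ≃ᵢ X) (Φ (g⁻¹ • s)) = Φ s := by rw [← hequi, smul_inv_smul]
  have e4 := dist_triangle4 ((g : X ≃ᵢ X) x) (Φ s) y x
  rw [← e3, IsometryEquiv.dist_eq, dist_comm x, e3] at e4
  linarith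

theorem isCompact_stabilizer_measure [Nonempty X] (hX : IsCAT0 X) [CompactSpace (limitSet G)]
    (hclosed : IsClosed (G : Set (X ≃ᵢ X)))
    {Φ : limitTriples G → X} (hΦ : Continuous Φ)
    (hequi : ∀ (g : G) (t : limitTriples G), Φ (g • t) = (g : X ≃ᵢ X) (Φ t))
    (μ : measuresGeThree G) : IsCompact (MulAction.stabilizer G μ : Set G) := by
  obtain ⟨x⟩ := ‹Nonempty X›
  have : Nonempty X := ⟨x⟩
  have := hX.metrizableSpace_limitSet (G := G)
  obtain ⟨C, hC⟩ := exists_nhds_forall_dist_le hX hΦ hequi μ.1 μ.2 x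
  refine (isCompact_subgroup hclosed x C).of_isClosed_subset ?_ fun g hg => ?_
  · have : (MulAction.stabilizer G μ : Set G) = (fun g : G => g • μ.1) ⁻¹' {μ.1} := by
      ext g
      exact ⟨fun h => congrArg Subtype.val h, fun h => Subtype.ext h⟩
    rw [this]
    exact isClosed_singleton.preimage (continuous_smul_measure hX μ.1)
  · exact hC.self_of_nhds g (congrArg Subtype.val hg)

/-- Group elements that move `μ` towards a limit `μ'` of the orbit have bounded displacement, hence
converge along the ultrafilter; continuity puts `μ'` in the orbit. -/
theorem isClosed_orbit_measure [Nonempty X] (hX : IsCAT0 X) [CompactSpace (limitSet G)]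
    (hclosed : IsClosed (G : Set (X ≃ᵢ X)))
    {Φ : limitTriples G → X} (hΦ : Continuous Φ)
    (hequi : ∀ (g : G) (t : limitTriples G), Φ (g • t) = (g : X ≃ᵢ X) (Φ t))
    (μ : measuresGeThree G) : IsClosed (MulAction.orbit G μ) := by
  obtain ⟨x⟩ := ‹Nonempty X›
  have : Nonempty X := ⟨x⟩
  have := hX.metrizableSpace_limitSet (G := G)
  rw [isClosed_iff_ultrafilter]
  intro μ' U hU hmem
  obtain ⟨C, hC⟩ := exists_nhds_forall_dist_le hX hΦ hequi μ.1 μ'.2 x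
  -- A total choice of group elements, with the irrelevant value 1 off the orbit.
  have hex : ∀ ν : measuresGeThree G, ∃ g : G, ν ∈ MulAction.orbit G μ → g • μ = ν := by
    intro ν
    by_cases h : ν ∈ MulAction.orbit G μ
    · obtain ⟨g, hg⟩ := h
      exact ⟨g, fun _ => hg⟩
    · exact ⟨1, fun h' => absurd h' h⟩
  choose g hg using hex
  have hval : Tendsto (Subtype.val : measuresGeThree G → ProbabilityMeasure (limitSet G)) U
      (𝓝 μ'.1) := (continuous_subtype_val.tendsto μ').mono_left hU
  have hmem' : ∀ᶠ ν in (U : Filter (measuresGeThree G)), g ν • μ = ν := by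
    filter_upwards [hmem] with ν hν
    exact hg ν hν
  obtain ⟨g₀, hg₀⟩ := exists_tendsto_subgroup hclosed U (g := g) (x := x) (C := C) (by
    filter_upwards [hval.eventually hC, hmem'] with ν h1 h2
    exact h1 (g ν) (congrArg Subtype.val h2))
  have hlim : Tendsto (Subtype.val : measuresGeThree G → ProbabilityMeasure (limitSet G)) U
      (𝓝 (g₀ • μ.1)) := by
    refine (((continuous_smul_measure hX μ.1).tendsto g₀).comp hg₀).congr' ?_
    filter_upwards [hmem'] with ν h
    exact congrArg Subtype.val h
  exact ⟨g₀, Subtype.ext (tendsto_nhds_unique hlim hval)⟩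

theorem isTameAction_measures [Nonempty X] (hX : IsCAT0 X) [CompactSpace (limitSet G)]
    (hclosed : IsClosed (G : Set (X ≃ᵢ X)))
    {Φ : limitTriples G → X} (hΦ : Continuous Φ)
    (hequi : ∀ (g : G) (t : limitTriples G), Φ (g • t) = (g : X ≃ᵢ X) (Φ t)) :
    IsTameAction G (measuresGeThree G) := by
  have := hX.metrizableSpace_limitSet (G := G)
  let _ := TopologicalSpace.metrizableSpaceMetric (limitSet G)
  let _ := TopologicalSpace.pseudoMetrizableSpacePseudoMetric (ProbabilityMeasure (limitSet G))
  have : SecondCountableTopology (ProbabilityMeasure (limitSet G)) := inferInstance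
  have : SecondCountableTopology (measuresGeThree G) :=
    TopologicalSpace.Subtype.secondCountableTopology _
  have : ContinuousConstSMul G (measuresGeThree G) :=
    ⟨fun g => ((continuous_smul_measure_const g).comp continuous_subtype_val).subtype_mk _⟩
  exact isTameAction_of_isClosed_orbit (isClosed_orbit_measure hX hclosed hΦ hequi)

end Proper

end RankOneCAT0

theorem mainTheorem7 {X : Type*} [MetricSpace X] [ProperSpace X]
    (hX : RankOneCAT0.IsCAT0 X)
    (G : Subgroup (X ≃ᵢ X))
    (hclosed : IsClosed (G : Set (X ≃ᵢ X)))
    (hnonel : RankOneCAT0.IsNonElementary G)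
    (hrank : ∃ g ∈ G, RankOneCAT0.IsRankOne g)
    (htrans : ∀ a b c d : RankOneCAT0.limitSet G, a ≠ b → c ≠ d →
      ∃ g : G, g • a = c ∧ g • b = d) :
    RankOneCAT0.IsTameAction G (RankOneCAT0.measuresGeThree G) ∧
    (∀ μ : RankOneCAT0.measuresGeThree G, IsCompact (MulAction.stabilizer G μ : Set G)) ∧
    ProperSMul G (RankOneCAT0.limitTriples G) ∧
    ∃ R > 0, ∃ Φ : RankOneCAT0.limitTriples G → X,
      Continuous Φ ∧
      (∀ (g : G) (t : RankOneCAT0.limitTriples G), Φ (g • t) = (g : X ≃ᵢ X) (Φ t)) ∧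
      ∀ t : RankOneCAT0.limitTriples G,
        (RankOneCAT0.quasiCenters R t).Nonempty ∧
        IsCompact (RankOneCAT0.quasiCenters R t) ∧
        RankOneCAT0.IsCenter (RankOneCAT0.quasiCenters R t) (Φ t) := by
  have hne : Nonempty X := by
    obtain ⟨g, -, B, -, τ, -, γ, -⟩ := hrank
    exact ⟨γ 0⟩
  have hΛ : IsClosed (RankOneCAT0.limitSet G : Set (RankOneCAT0.Boundary X)) := by
    refine RankOneCAT0.isClosed_limitSet fun a b => ?_
    -- Completing `a` and `b` to pairs of distinct points reduces transitivity on points to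
    -- transitivity on pairs.
    obtain ⟨c, hac⟩ := RankOneCAT0.exists_limitSet_ne hnonel a
    obtain ⟨d, hbd⟩ := RankOneCAT0.exists_limitSet_ne hnonel b
    obtain ⟨g, hg, -⟩ := htrans a c b d hac hbd
    exact ⟨g, hg⟩
  have := hX.compactSpace_limitSet hΛ
  obtain ⟨B, hB, hpair⟩ := RankOneCAT0.exists_contractingPair hX hrank htrans
  obtain ⟨R, hR, Φ, hΦ, hequi, hcen⟩ :=
    RankOneCAT0.exists_continuous_center hX hclosed hΛ htrans hB hpair
  exact ⟨RankOneCAT0.isTameAction_measures hX hclosed hΦ hequi,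
    RankOneCAT0.isCompact_stabilizer_measure hX hclosed hΦ hequi,
    RankOneCAT0.properSMul_limitTriples hX hclosed hΦ hequi,
    R, hR, Φ, hΦ, hequi, hcen⟩
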